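/- **Theorem (Asymptotic conditional validity of split conformal prediction).** *Model.* Fix $d,p\ge 0$. For each $n$, let $(Y_i,X_i,\xi_i)_{1\le i\le 2n+1}$ be i.i.d. triplets with values in $\mathbb R\times\mathbb R^d\times[0,1]$, where $\xi_i$ is uniform on $[0,1]$, and let $(\eta_{ij})_{1\le i<j\le 2n+1}$ be i.i.d. uniform on $[0,1]$ and independent of the triplets. Let $w:[0,1]^2\to[0,\infty)$ be measurable and symmetric with $\int_0^1\!\int_0^1 w(u,v)\,du\,dv=1$, let $\rho_n$ be real numbers, and let $A$ be the adjacency matrix with $A_{ii}=0$ and $A_{ij}=A_{ji}=\mathbf 1\{\eta_{ij}\le \min(\rho_n w(\xi_i,\xi_j),1)\}$ for $i<j$. (All variables and laws may depend on $n$.) Let $Z_1,\dots,Z_{2n+1}$ be $\mathbb R^p$-valued random vectors such that the triples $(Y_i,X_i,Z_i)_{1\le i\le 2n+1}$ are i.i.d. and continuous, i.e. their common law has a density with respect to Lebesgue measure on $\mathbb R^{1+d+p}$. *Network covariates.* Let $(\hat Z_1,\dots,\hat Z_{2n+1})=\zeta_n(A,X_1,\dots,X_{2n+1})\in(\mathbb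 R^p)^{2n+1}$ for a measurable $\zeta_n$ such that, for every permutation $\sigma$ of $\{1,\dots,2n+1\}$, almost surely $$(\hat Z_{\sigma(1)},\dots,\hat Z_{\sigma(2n+1)})=\zeta_n\big((A_{\sigma(i)\sigma(j)})_{i,j},X_{\sigma(1)},\dots,X_{\sigma(2n+1)}\big).$$ *Estimator.* Let $F_{Y|X,Z}(y\,|\,x,z)$ be the conditional distribution function of $Y_{2n+1}$ given $(X_{2n+1},Z_{2n+1})=(x,z)$. Consider a (jointly measurable) real-valued estimator of it computed from $n$ training triples. For $0\le r\le n$, let $\hat F^{(r)}(y\,|\,x,z)$ be the estimator computed from $(Y_1,X_1,Z_1),\dots,(Y_r,X_r,Z_r),(Y_{r+1},X_{r+1},\hat Z_{r+1}),\dots,(Y_n,X_n,\hat Z_n)$, and put $\hat F_n=\hat F^{(0)}$, $\tilde F=\hat F^{(n)}$. *Conformal set.* Let $0<\alpha<1$, let $s(y,x,z)=|1/2-\hat F_n(y\,|\,x,z)|$ and $S_i=s(Y_i,X_i,\hat Z_i)$ for $n+1\le i\le 2n$, and let $d_n=\inf\{t\in\mathbb R:\frac1n\#\{n+1\le i\le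 2n: S_i\le t\}\ge(1-\alpha)(1+\frac1n)\}$ be the empirical quantile of the $S_i$ at level $(1-\alpha)(1+\frac1n)$ (with $\inf\emptyset=+\infty$). Put $\hat C_n(X_{2n+1},\hat Z_{2n+1})=\{y\in\mathbb R: s(y,X_{2n+1},\hat Z_{2n+1})\le d_n\}$. *Conclusion.* 1. Suppose that, as $n\to\infty$, (a) $\displaystyle\max_{1\le r\le n}\max_{1\le i\le n+1}\big|\hat F^{(r)}(Y_{n+i}\,|\,X_{n+i},Z_{n+i})-\hat F^{(r-1)}(Y_{n+i}\,|\,X_{n+i},Z_{n+i})\big|=o_P(1/n)$; (b) $\displaystyle\max_{1\le i\le n+1}\big|\hat F_n(Y_{n+i}\,|\,X_{n+i},\hat Z_{n+i})-\hat F_n(Y_{n+i}\,|\,X_{n+i},Z_{n+i})\big|=o_P(1)$; (c) $\displaystyle\mathbb E\big|\tilde F(Y_{2n+1}\,|\,X_{2n+1},Z_{2n+1})-F_{Y|X,Z}(Y_{2n+1}\,|\,X_{2n+1},Z_{2n+1})\big|=o(1)$. Then $$P\big(Y_{2n+1}\in\hat C_n(X_{2n+1},\hat Z_{2n+1})\,\big|\,X_{2n+1},Z_{2n+1}\big)=1-\alpha+o_P(1).$$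 2. Whether or not (a)–(c) hold, $P\big(Y_{2n+1}\in\hat C_n(X_{2n+1},\hat Z_{2n+1})\big)\ge 1-\alpha$ for every $n\ge1$. -/

import Mathlib

open MeasureTheory ProbabilityTheory Filter Topology

noncomputable section

namespace NetConf

/-- A point `(y, x, z)` of `ℝ × ℝ^d × ℝ^p`: response, node covariate, network covariate. -/
abbrev Triple (d p : ℕ) : Type := ℝ × (Fin d → ℝ) × (Fin p → ℝ)

/-! ### Independent triplets and the sparse graphon model -/

/-- The random variables `T i` are independent and identically distributed. -/
structure IsIID {ι Ω E : Type*} [MeasurableSpace Ω] [MeasurableSpace E]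
    (T : ι → Ω → E) (P : Measure Ω) : Prop where
  indep : iIndepFun T P
  identDistrib : ∀ i j, IdentDistrib (T i) (T j) P P

/-- The adjacency matrix `A i j = A j i = 1(η i j ≤ min (ρ w(ξ i, ξ j)) 1)` for `i < j`, without
self-loops. Only the values `η i j` with `i < j` are used. -/
def adjacency {N : ℕ} (ρ : ℝ) (w : unitInterval → unitInterval → ℝ)
    (ξ : Fin N → unitInterval) (η : Fin N → Fin N → unitInterval) : Fin N → Fin N → ℝ :=
  fun i j =>
    if i = j then 0
    else if (η (min i j) (max i j) : ℝ) ≤ min (ρ * w (ξ (min i j)) (ξ (max i j))) 1 then 1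
    else 0

/-- A graphon: measurable, non-negative, symmetric, with integral one over the unit square. -/
structure IsGraphon (w : unitInterval → unitInterval → ℝ) : Prop where
  measurable : Measurable (Function.uncurry w)
  nonneg : ∀ u v, 0 ≤ w u v
  symm : ∀ u v, w u v = w v u
  integral_eq_one : ∫ q : unitInterval × unitInterval, w q.1 q.2 = 1

/-- The randomness of the independent triplets and graphon model on `N` nodes: i.i.d. triplets
`(Y i, X i, ξ i)` with `ξ i` uniform on `[0,1]`, and i.i.d. uniform `η i j`, `i < j`,
independent of all the triplets. -/
structure IsIndependentTriplets {N d : ℕ} {Ω : Type*} [MeasurableSpace Ω] (P : Measure Ω)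
    (Y : Fin N → Ω → ℝ) (X : Fin N → Ω → Fin d → ℝ) (ξ : Fin N → Ω → unitInterval)
    (η : Fin N → Fin N → Ω → unitInterval) : Prop where
  measurable_Y : ∀ i, Measurable (Y i)
  measurable_X : ∀ i, Measurable (X i)
  measurable_ξ : ∀ i, Measurable (ξ i)
  measurable_η : ∀ i j, i < j → Measurable (η i j)
  iid_triplets : IsIID (fun i ω => (Y i ω, X i ω, ξ i ω)) P
  uniform_ξ : ∀ i, P.map (ξ i) = volume
  iid_η : IsIID (fun (e : {e : Fin N × Fin N // e.1 < e.2}) ω => η e.1.1 e.1.2 ω) P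
  uniform_η : ∀ i j, i < j → P.map (η i j) = volume
  indep_η : IndepFun (fun ω i => (Y i ω, X i ω, ξ i ω))
    (fun ω (e : {e : Fin N × Fin N // e.1 < e.2}) => η e.1.1 e.1.2 ω) P

/-- Permutation equivariance of the network covariates `ζ(A, X)`: almost surely, relabelling the
nodes relabels the covariates accordingly. -/
def IsPermEquivariant {N d p : ℕ} {Ω : Type*} [MeasurableSpace Ω] (P : Measure Ω)
    (ζ : (Fin N → Fin N → ℝ) → (Fin N → Fin d → ℝ) → Fin N → Fin p → ℝ)
    (A : Ω → Fin N → Fin N → ℝ) (X : Fin N → Ω → Fin d → ℝ) : Prop :=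
  ∀ σ : Equiv.Perm (Fin N), ∀ᵐ ω ∂P,
    (fun i => ζ (A ω) (fun k => X k ω) (σ i)) =
      ζ (fun i j => A ω (σ i) (σ j)) (fun i => X (σ i) ω)

/-! ### Split conformal prediction -/

/-- Empirical quantile of `S` at level `τ`: the least `t` such that a fraction at least `τ` of the
values is at most `t`. It is `⊤` if there is no such `t`, that is, if `τ > 1`. -/
def empiricalQuantile {n : ℕ} (S : Fin n → ℝ) (τ : ℝ) : EReal :=
  sInf ((fun t : ℝ => (t : EReal)) ''
    {t : ℝ | τ ≤ ((Finset.univ.filter (fun i => S i ≤ t)).card : ℝ) / (n : ℝ)})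

/-- The split conformal prediction set with score `s`, trained on `D₁` and calibrated on `D₂`, at
the new covariates `(x, z)`. -/
def splitConformalSet {n d p : ℕ} (s : (Fin n → Triple d p) → Triple d p → ℝ) (α : ℝ)
    (D₁ D₂ : Fin n → Triple d p) (x : Fin d → ℝ) (z : Fin p → ℝ) : Set ℝ :=
  {y | (s D₁ (y, x, z) : EReal) ≤
    empiricalQuantile (fun i => s D₁ (D₂ i)) ((1 - α) * (1 + 1 / (n : ℝ)))}

/-- The score `|1/2 - F̂(y | x, z)|` of a conditional distribution function estimator, where
`F D (y, x, z)` is the estimate at `(y | x, z)` computed from the training sample `D`. -/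
def cdfScore {n d p : ℕ} (F : (Fin n → Triple d p) → Triple d p → ℝ) :
    (Fin n → Triple d p) → Triple d p → ℝ :=
  fun D v => |1 / 2 - F D v|

/-- Nodes of the training set: the first `n` of the `2n+1` nodes. -/
def trainNode {n : ℕ} (i : Fin n) : Fin (2 * n + 1) := ⟨i, by omega⟩

/-- Nodes of the validation set: the next `n` nodes. -/
def validNode {n : ℕ} (i : Fin n) : Fin (2 * n + 1) := ⟨n + i, by omega⟩

/-- Nodes of the validation set and the test node: the last `n+1` nodes. -/
def evalNode {n : ℕ} (i : Fin (n + 1)) : Fin (2 * n + 1) := ⟨n + i, by omega⟩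

/-- The test node: the last one. -/
def testNode (n : ℕ) : Fin (2 * n + 1) := Fin.last (2 * n)

/-- The training sample `(y i, x i, z i)`, `i ≤ r`, followed by `(y i, x i, zhat i)`,
`r < i ≤ n` (nodes counted from one). -/
def mixedSample {n d p : ℕ} (r : ℕ) (y : Fin (2 * n + 1) → ℝ) (x : Fin (2 * n + 1) → Fin d → ℝ)
    (z zhat : Fin (2 * n + 1) → Fin p → ℝ) : Fin n → Triple d p :=
  fun i => (y (trainNode i), x (trainNode i),
    if (i : ℕ) < r then z (trainNode i) else zhat (trainNode i))

/-- The split conformal set for the test node computed from the data with the score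
`|1/2 - F̂|`. It does not use the response of the test node. -/
def conformalSet {n d p : ℕ} (F : (Fin n → Triple d p) → Triple d p → ℝ) (α : ℝ)
    (y : Fin (2 * n + 1) → ℝ) (x : Fin (2 * n + 1) → Fin d → ℝ)
    (zhat : Fin (2 * n + 1) → Fin p → ℝ) : Set ℝ :=
  splitConformalSet (cdfScore F) α
    (fun i => (y (trainNode i), x (trainNode i), zhat (trainNode i)))
    (fun i => (y (validNode i), x (validNode i), zhat (validNode i)))
    (x (testNode n)) (zhat (testNode n))

/-! ### Asymptotic notions -/

/-- `R n = o_P(a n)`, where the `n`-th variable lives on its own probability space and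
`a n > 0` for large `n`. -/
def IsLittleOP {Ω : ℕ → Type*} [∀ n, MeasurableSpace (Ω n)] (P : ∀ n, Measure (Ω n))
    (R : ∀ n, Ω n → ℝ) (a : ℕ → ℝ) : Prop :=
  ∀ ε : ℝ, 0 < ε → Tendsto (fun n => P n {ω | ε * a n < |R n ω|}) atTop (𝓝 0)

/-- The conditional distribution function of `Y` given `(X, Z)`, evaluated at `(y, x, z)`. -/
def trueCDF {d p : ℕ} {Ω : Type*} [MeasurableSpace Ω] (P : Measure Ω) [IsFiniteMeasure P]
    (Y : Ω → ℝ) (X : Ω → Fin d → ℝ) (Z : Ω → Fin p → ℝ) (v : Triple d p) : ℝ :=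
  (condDistrib Y (fun ω => (X ω, Z ω)) P (v.2.1, v.2.2)).real (Set.Iic v.1)

end NetConf

end

open NetConf

/-! Unconditional validity rests on exchangeability. The observed triples are a fixed measurable
function of i.i.d. triplets and i.i.d. edge variables, and by equivariance relabelling the nodes
amounts to relabelling these inputs, whose joint law does not change (`observed_exchangeable`).
Coverage is a rank event: fewer than `(1 - α)(n + 1)` of the `n + 1` evaluation scores lie strictly
below the test score. By exchangeability this event has the same probability for each evaluation
node, and at least `(1 - α)(n + 1)` nodes always satisfy it (`le_card_rank_lt`), so each probability
is at least `1 - α`.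

For conditional validity, the conformal set is compared with an oracle that knows the true
conditional distribution function. Since the triples have a density, the conditional laws of the
response are atomless, so the probability integral transform makes the oracle score uniform on `[0,
1/2]` given the covariates (`condExp_trueScore_le`). The event that it is at most `(1 - α)/2` thus
has conditional probability exactly `1 - α`.

The estimated score at each evaluation node is close to the oracle score: replacing the training
covariates one at a time costs `n` increments of size `o(1/n)`, replacing the evaluation covariate
costs `o(1)`, and what remains is the error of the estimator trained on i.i.d. triples, small in
mean. The estimated scores are dependent through the network and the training sample, but the oracle
scores are independent, so their empirical distribution concentrates. The ranks then force the two
coverage events to agree unless the test oracle score is near the threshold (`card_lt_iff_of_close`,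
`measure_coverage_ne_le`). Finally, conditional expectation contracts the `L¹` norm, so events that
differ with vanishing probability have asymptotically equal conditional probabilities
(`measure_condExp_sub_le`). -/

namespace NetConf

/-! ### Permutation invariance of the observed sample -/

/-- The joint law of an i.i.d. family is invariant under permutations of the indices. -/
lemma IsIID.map_perm {ι Ω E : Type*} [Fintype ι] [MeasurableSpace Ω] [MeasurableSpace E]
    {P : Measure Ω} [IsProbabilityMeasure P] {T : ι → Ω → E} (h : IsIID T P)
    (hT : ∀ i, Measurable (T i)) (σ : Equiv.Perm ι) :
    P.map (fun ω i => T (σ i) ω) = P.map (fun ω i => T i ω) := by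
  rw [(iIndepFun_iff_map_fun_eq_pi_map fun i => (hT i).aemeasurable).1 h.indep,
    (iIndepFun_iff_map_fun_eq_pi_map fun i => (hT (σ i)).aemeasurable).1
      (h.indep.precomp σ.injective)]
  congr 1
  funext i
  exact (h.identDistrib (σ i) i).map_eq

/-- The pairs `i < j` of nodes. -/
abbrev Edge (N : ℕ) : Type := {e : Fin N × Fin N // e.1 < e.2}

/-- The pair formed by two distinct nodes. -/
def edge {N : ℕ} (i j : Fin N) (h : i ≠ j) : Edge N :=
  ⟨(min i j, max i j), min_lt_max.2 h⟩

lemma edge_comm {N : ℕ} (i j : Fin N) (h : i ≠ j) : edge i j h = edge j i h.symm := by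
  simp [edge, min_comm, max_comm]

lemma edge_eq_self {N : ℕ} (e : Edge N) : edge e.1.1 e.1.2 e.2.ne = e := by
  simp [edge, min_eq_left e.2.le, max_eq_right e.2.le]

/-- The image of a pair of nodes under a map of the nodes. -/
def edgeMap {N : ℕ} (σ : Equiv.Perm (Fin N)) (e : Edge N) : Edge N :=
  edge (σ e.1.1) (σ e.1.2) (σ.injective.ne e.2.ne)

lemma edgeMap_edge {N : ℕ} (σ : Equiv.Perm (Fin N)) (i j : Fin N) (h : i ≠ j) :
    edgeMap σ (edge i j h) = edge (σ i) (σ j) (σ.injective.ne h) := by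
  rcases lt_or_gt_of_ne h with hij | hij
  · simp [edgeMap, edge, min_eq_left hij.le, max_eq_right hij.le]
  · rw [edge_comm i j, edge_comm (σ i)]
    simp [edgeMap, edge, min_eq_left hij.le, max_eq_right hij.le]

/-- The permutation of the pairs of nodes induced by a permutation of the nodes. -/
def edgePerm {N : ℕ} (σ : Equiv.Perm (Fin N)) : Equiv.Perm (Edge N) where
  toFun := edgeMap σ
  invFun := edgeMap σ.symm
  left_inv e := by
    conv_lhs => rw [← edge_eq_self e]
    rw [edgeMap_edge, edgeMap_edge]
    simpa using edge_eq_self e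
  right_inv e := by
    conv_lhs => rw [← edge_eq_self e]
    rw [edgeMap_edge, edgeMap_edge]
    simpa using edge_eq_self e

/-- The adjacency matrix as a function of the latent positions and of one variable per pair. -/
noncomputable def edgeAdjacency {N : ℕ} (ρ : ℝ) (w : unitInterval → unitInterval → ℝ)
    (ξ : Fin N → unitInterval) (h : Edge N → unitInterval) : Fin N → Fin N → ℝ :=
  fun i j =>
    if hij : i = j then 0
    else if (h (edge i j hij) : ℝ) ≤ min (ρ * w (ξ i) (ξ j)) 1 then 1
    else 0

/-- Symmetry of `w` removes the ordering of the two nodes from the threshold, which makes the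
relabelling rule below clean. -/
lemma adjacency_eq_edgeAdjacency {N : ℕ} (ρ : ℝ) {w : unitInterval → unitInterval → ℝ}
    (hw : ∀ u v, w u v = w v u) (ξ : Fin N → unitInterval) (η : Fin N → Fin N → unitInterval) :
    adjacency ρ w ξ η = edgeAdjacency ρ w ξ (fun e => η e.1.1 e.1.2) := by
  funext i j
  by_cases hij : i = j
  · simp [adjacency, edgeAdjacency, hij]
  · have hsymm : w (ξ (min i j)) (ξ (max i j)) = w (ξ i) (ξ j) := by
      rcases le_total i j with h | h
      · rw [min_eq_left h, max_eq_right h]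
      · rw [min_eq_right h, max_eq_left h, hw]
    simp [adjacency, edgeAdjacency, hij, edge, hsymm]

/-- A relabelled graph is again a graph of the model, with permuted positions and edge variables;
this transfers invariance of the inputs to the adjacency matrix. -/
lemma edgeAdjacency_perm {N : ℕ} (ρ : ℝ) (w : unitInterval → unitInterval → ℝ)
    (ξ : Fin N → unitInterval) (h : Edge N → unitInterval) (σ : Equiv.Perm (Fin N)) :
    (fun i j => edgeAdjacency ρ w ξ h (σ i) (σ j)) =
      edgeAdjacency ρ w (fun i => ξ (σ i)) (fun e => h (edgePerm σ e)) := by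
  funext i j
  by_cases hij : i = j
  · simp [edgeAdjacency, hij]
  · simp [edgeAdjacency, hij, edgePerm, edgeMap_edge]

lemma measurable_edgeAdjacency {N : ℕ} (ρ : ℝ) {w : unitInterval → unitInterval → ℝ}
    (hw : Measurable (Function.uncurry w)) :
    Measurable fun q : (Fin N → unitInterval) × (Edge N → unitInterval) =>
      edgeAdjacency ρ w q.1 q.2 := by
  refine measurable_pi_lambda _ fun i => measurable_pi_lambda _ fun j => ?_
  by_cases hij : i = j
  · simp [edgeAdjacency, hij]
  · simp only [edgeAdjacency, hij, dite_false]
    refine Measurable.ite (measurableSet_le ?_ ?_) measurable_const measurable_const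
    · exact measurable_subtype_coe.comp ((measurable_pi_apply _).comp measurable_snd)
    · refine Measurable.min (Measurable.const_mul ?_ _) measurable_const
      have hij : Measurable fun q : (Fin N → unitInterval) × (Edge N → unitInterval) =>
          (q.1 i, q.1 j) := by fun_prop
      exact hw.comp hij

/-- The observed triples as a function of the triplets and the edge variables. -/
noncomputable def observed {N d p : ℕ} (ρ : ℝ) (w : unitInterval → unitInterval → ℝ)
    (ζ : (Fin N → Fin N → ℝ) → (Fin N → Fin d → ℝ) → Fin N → Fin p → ℝ)
    (q : (Fin N → ℝ × (Fin d → ℝ) × unitInterval) × (Edge N → unitInterval)) :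
    Fin N → Triple d p :=
  fun i => ((q.1 i).1, (q.1 i).2.1,
    ζ (edgeAdjacency ρ w (fun k => (q.1 k).2.2) q.2) (fun k => (q.1 k).2.1) i)

lemma measurable_observed {N d p : ℕ} (ρ : ℝ) {w : unitInterval → unitInterval → ℝ}
    (hw : Measurable (Function.uncurry w))
    {ζ : (Fin N → Fin N → ℝ) → (Fin N → Fin d → ℝ) → Fin N → Fin p → ℝ}
    (hζ : Measurable (Function.uncurry ζ)) : Measurable (observed ρ w ζ) := by
  have hA : Measurable fun q : (Fin N → ℝ × (Fin d → ℝ) × unitInterval) ×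
      (Edge N → unitInterval) => edgeAdjacency ρ w (fun k => (q.1 k).2.2) q.2 :=
    (measurable_edgeAdjacency ρ hw).comp
      (Measurable.prodMk (by fun_prop) measurable_snd)
  have hX : Measurable fun q : (Fin N → ℝ × (Fin d → ℝ) × unitInterval) ×
      (Edge N → unitInterval) => fun k => (q.1 k).2.1 := by fun_prop
  have hz := hζ.comp (hA.prodMk hX)
  refine measurable_pi_lambda _ fun i => Measurable.prodMk (by fun_prop)
    (Measurable.prodMk (by fun_prop) ((measurable_pi_apply i).comp hz))

lemma observed_eq {N d p : ℕ} {Ω : Type*}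
    {Y : Fin N → Ω → ℝ} {X : Fin N → Ω → Fin d → ℝ} {ξ : Fin N → Ω → unitInterval}
    {η : Fin N → Fin N → Ω → unitInterval} {ρ : ℝ} {w : unitInterval → unitInterval → ℝ}
    {ζ : (Fin N → Fin N → ℝ) → (Fin N → Fin d → ℝ) → Fin N → Fin p → ℝ}
    {A : Ω → Fin N → Fin N → ℝ} {Zhat : Fin N → Ω → Fin p → ℝ} (hw : ∀ u v, w u v = w v u)
    (hA : ∀ ω, A ω = adjacency ρ w (fun i => ξ i ω) (fun i j => η i j ω))
    (hZhat : ∀ i ω, Zhat i ω = ζ (A ω) (fun k => X k ω) i) :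
    (fun ω i => ((Y i ω, X i ω, Zhat i ω) : Triple d p)) = fun ω =>
      observed ρ w ζ ((fun i => (Y i ω, X i ω, ξ i ω)), fun e => η e.1.1 e.1.2 ω) := by
  funext ω i
  simp only [observed, hZhat, hA, adjacency_eq_edgeAdjacency ρ hw]

section Exchangeable

variable {N d p : ℕ} {Ω : Type*} [MeasurableSpace Ω] {P : Measure Ω}
  {Y : Fin N → Ω → ℝ} {X : Fin N → Ω → Fin d → ℝ} {ξ : Fin N → Ω → unitInterval}
  {η : Fin N → Fin N → Ω → unitInterval} {ρ : ℝ} {w : unitInterval → unitInterval → ℝ}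
  {ζ : (Fin N → Fin N → ℝ) → (Fin N → Fin d → ℝ) → Fin N → Fin p → ℝ}
  {A : Ω → Fin N → Fin N → ℝ} {Zhat : Fin N → Ω → Fin p → ℝ}

lemma IsIndependentTriplets.measurable_inputs (hs : IsIndependentTriplets P Y X ξ η) :
    Measurable (fun ω => ((fun i => (Y i ω, X i ω, ξ i ω)), fun (e : Edge N) => η e.1.1 e.1.2 ω)) :=
  (measurable_pi_lambda _ fun i =>
    (hs.measurable_Y i).prodMk ((hs.measurable_X i).prodMk (hs.measurable_ξ i))).prodMk
    (measurable_pi_lambda _ fun e => hs.measurable_η _ _ e.2)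

/-- The inputs of the model have the same joint law after relabelling the nodes. -/
lemma IsIndependentTriplets.map_perm [IsProbabilityMeasure P]
    (hs : IsIndependentTriplets P Y X ξ η) (σ : Equiv.Perm (Fin N)) :
    P.map (fun ω => ((fun i => (Y (σ i) ω, X (σ i) ω, ξ (σ i) ω)),
        fun (e : Edge N) => η (edgePerm σ e).1.1 (edgePerm σ e).1.2 ω)) =
      P.map (fun ω => ((fun i => (Y i ω, X i ω, ξ i ω)),
        fun (e : Edge N) => η e.1.1 e.1.2 ω)) := by
  have ht : ∀ i, Measurable fun ω => (Y i ω, X i ω, ξ i ω) := fun i =>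
    (hs.measurable_Y i).prodMk ((hs.measurable_X i).prodMk (hs.measurable_ξ i))
  have he : ∀ e : Edge N, Measurable fun ω => η e.1.1 e.1.2 ω := fun e => hs.measurable_η _ _ e.2
  have hind := hs.indep_η
  have hind' := hind.comp
    (φ := fun (t : Fin N → ℝ × (Fin d → ℝ) × unitInterval) i => t (σ i))
    (ψ := fun (h : Edge N → unitInterval) e => h (edgePerm σ e)) (by fun_prop) (by fun_prop)
  rw [hind.map_prod_eq_prod_map_map (measurable_pi_lambda _ ht).aemeasurable
    (measurable_pi_lambda _ he).aemeasurable]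
  refine (hind'.map_prod_eq_prod_map_map
    (measurable_pi_lambda _ fun i => ht (σ i)).aemeasurable
    (measurable_pi_lambda _ fun e => he (edgePerm σ e)).aemeasurable).trans ?_
  -- By independence both joint laws are products, and each i.i.d. factor is invariant under its own
  -- permutation.
  congr 1
  · exact hs.iid_triplets.map_perm ht σ
  · exact hs.iid_η.map_perm he (edgePerm σ)

lemma measurable_observed_triples (hw : IsGraphon w) (hs : IsIndependentTriplets P Y X ξ η)
    (hA : ∀ ω, A ω = adjacency ρ w (fun i => ξ i ω) (fun i j => η i j ω))
    (hζ : Measurable (Function.uncurry ζ))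
    (hZhat : ∀ i ω, Zhat i ω = ζ (A ω) (fun k => X k ω) i) :
    Measurable fun ω i => ((Y i ω, X i ω, Zhat i ω) : Triple d p) := by
  rw [observed_eq (Y := Y) hw.symm hA hZhat]
  exact (measurable_observed ρ hw.measurable hζ).comp hs.measurable_inputs

/-- The observed triples `(Y i, X i, Zhat i)` are exchangeable. -/
theorem observed_exchangeable [IsProbabilityMeasure P] (hw : IsGraphon w)
    (hs : IsIndependentTriplets P Y X ξ η)
    (hA : ∀ ω, A ω = adjacency ρ w (fun i => ξ i ω) (fun i j => η i j ω))
    (hζ : Measurable (Function.uncurry ζ)) (hequiv : IsPermEquivariant P ζ A X)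
    (hZhat : ∀ i ω, Zhat i ω = ζ (A ω) (fun k => X k ω) i) (σ : Equiv.Perm (Fin N)) :
    P.map (fun ω i => ((Y (σ i) ω, X (σ i) ω, Zhat (σ i) ω) : Triple d p)) =
      P.map (fun ω i => ((Y i ω, X i ω, Zhat i ω) : Triple d p)) := by
  have hobs := measurable_observed (d := d) (p := p) ρ hw.measurable hζ
  -- Equivariance is what makes the relabelled output the same function `observed` of the relabelled
  -- inputs, up to a null set.
  have hperm : (fun ω i => ((Y (σ i) ω, X (σ i) ω, Zhat (σ i) ω) : Triple d p)) =ᵐ[P]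
      fun ω => observed ρ w ζ ((fun i => (Y (σ i) ω, X (σ i) ω, ξ (σ i) ω)),
        fun e => η (edgePerm σ e).1.1 (edgePerm σ e).1.2 ω) := by
    filter_upwards [hequiv σ] with ω hω
    funext i
    have hi := congrFun hω i
    rw [hZhat, hi, hA, adjacency_eq_edgeAdjacency ρ hw.symm]
    simp only [observed]
    rw [edgeAdjacency_perm ρ w (fun i => ξ i ω) (fun e => η e.1.1 e.1.2 ω) σ]
  have hin : Measurable fun ω => ((fun i => (Y (σ i) ω, X (σ i) ω, ξ (σ i) ω)),
        fun (e : Edge N) => η (edgePerm σ e).1.1 (edgePerm σ e).1.2 ω) :=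
    (measurable_pi_lambda _ fun i => (hs.measurable_Y _).prodMk
      ((hs.measurable_X _).prodMk (hs.measurable_ξ _))).prodMk
      (measurable_pi_lambda _ fun e => hs.measurable_η _ _ (edgePerm σ e).2)
  rw [Measure.map_congr hperm]
  rw [observed_eq (Y := Y) hw.symm hA hZhat]
  have h1 := Measure.map_map (μ := P) hobs hin
  have h2 := Measure.map_map (μ := P) hobs hs.measurable_inputs
  rw [hs.map_perm σ] at h1
  exact h1.symm.trans h2

end Exchangeable

/-! ### Ranks, empirical quantiles and unconditional validity -/

/-- The counting function is constant between consecutive values of `S`. If the level is already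
reached strictly below `x`, it is reached at some `t < x`, which bounds the infimum away from `x`.
-/
lemma le_empiricalQuantile_iff {n : ℕ} (S : Fin n → ℝ) (τ x : ℝ) :
    (x : EReal) ≤ empiricalQuantile S τ ↔
      ((Finset.univ.filter (fun i => S i < x)).card : ℝ) / (n : ℝ) < τ := by
  constructor
  · intro h
    by_contra! hτ
    obtain ⟨t, htx, ht⟩ : ∃ t < x, ∀ i, S i < x → S i ≤ t := by
      -- The witness is the largest value below `x`; `x - 1` keeps the set nonempty when there is
      -- none.
      have hne : (insert (x - 1) ((Finset.univ.filter (fun i => S i < x)).image S)).Nonempty :=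
        Finset.insert_nonempty _ _
      refine ⟨Finset.max' _ hne, ?_, fun i hi => Finset.le_max' _ _ ?_⟩
      · rw [Finset.max'_lt_iff]
        intro y hy
        rcases Finset.mem_insert.1 hy with rfl | hy
        · linarith
        · obtain ⟨i, hi, rfl⟩ := Finset.mem_image.1 hy
          exact (Finset.mem_filter.1 hi).2
      · exact Finset.mem_insert_of_mem (Finset.mem_image_of_mem S (by simpa using hi))
    have hle : empiricalQuantile S τ ≤ (t : EReal) := by
      refine sInf_le ⟨t, hτ.trans ?_, rfl⟩
      gcongr with i _
      exact ht i
    exact absurd (EReal.coe_le_coe_iff.1 (h.trans hle)) (not_le.2 htx)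
  · intro h
    refine le_sInf ?_
    rintro _ ⟨t, ht, rfl⟩
    refine EReal.coe_le_coe_iff.2 (le_of_not_gt fun htx => ?_)
    refine absurd (lt_of_le_of_lt ?_ h) (not_lt.2 (show τ ≤ _ from ht))
    gcongr

/-- The score is at most the conformal quantile iff its rank is small. -/
lemma le_conformalQuantile_iff {n : ℕ} (hn : 1 ≤ n) (S : Fin n → ℝ) (β x : ℝ) :
    (x : EReal) ≤ empiricalQuantile S (β * (1 + 1 / (n : ℝ))) ↔
      ((Finset.univ.filter (fun i => S i < x)).card : ℝ) < β * (n + 1) := by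
  have hn' : (0 : ℝ) < n := by exact_mod_cast hn
  rw [le_empiricalQuantile_iff, div_lt_iff₀ hn']
  have : β * (1 + 1 / (n : ℝ)) * n = β * (n + 1) := by field_simp
  rw [this]

/-- At least `k` of the values have fewer than `k` values strictly below them. -/
lemma le_card_rank_lt {ι : Type*} [Fintype ι] (S : ι → ℝ) {k : ℝ}
    (hk : k ≤ Fintype.card ι) :
    k ≤ (Finset.univ.filter fun j =>
      ((Finset.univ.filter fun i => S i < S j).card : ℝ) < k).card := by
  classical
  set B := Finset.univ.filter fun j => ¬ ((Finset.univ.filter fun i => S i < S j).card : ℝ) < k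
    with hB
  rcases B.eq_empty_or_nonempty with h | h
  · have : (Finset.univ.filter fun j =>
      ((Finset.univ.filter fun i => S i < S j).card : ℝ) < k) = Finset.univ := by
      ext j
      by_contra hj
      have : j ∈ B := by simpa [hB] using hj
      simp [h] at this
    rw [this]
    simpa using hk
  -- Take the smallest score among the indices of large rank: the indices strictly below it, at
  -- least `k` in number, must all have small rank.
  · obtain ⟨j, hj, hmin⟩ := B.exists_min_image S h
    have hj' := (Finset.mem_filter.1 hj).2
    refine (not_lt.1 hj').trans ?_
    refine Nat.cast_le.2 (Finset.card_le_card fun i hi => ?_)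
    replace hi := (Finset.mem_filter.1 hi).2
    refine Finset.mem_filter.2 ⟨Finset.mem_univ i, ?_⟩
    by_contra hc
    exact absurd (hmin i (Finset.mem_filter.2 ⟨Finset.mem_univ i, hc⟩)) (not_le.2 hi)

lemma measurable_card_filter {α ι : Type*} [MeasurableSpace α] (s : Finset ι) {q : ι → α → Prop}
    [∀ a, DecidablePred fun i => q i a] (hq : ∀ i, MeasurableSet {a | q i a}) :
    Measurable fun a => ((s.filter fun i => q i a).card : ℝ) := by
  classical
  have : (fun a => ((s.filter fun i => q i a).card : ℝ)) =
      fun a => ∑ i ∈ s, if q i a then (1 : ℝ) else 0 := by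
    funext a
    simp
  rw [this]
  exact Finset.measurable_sum _ fun i _ => Measurable.ite (hq i) measurable_const measurable_const

/-- The scores of the validation nodes and of the test node (the last one). -/
def evalScore {E : Type*} {n : ℕ} (s : (Fin n → E) → E → ℝ) (v : Fin (2 * n + 1) → E)
    (i : Fin (n + 1)) : ℝ :=
  s (fun k => v (trainNode k)) (v (evalNode i))

lemma measurable_evalScore {E : Type*} [MeasurableSpace E] {n : ℕ} {s : (Fin n → E) → E → ℝ}
    (hs : Measurable (Function.uncurry s)) (i : Fin (n + 1)) :
    Measurable fun v => evalScore s v i := by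
  have : Measurable fun v : Fin (2 * n + 1) → E => ((fun k => v (trainNode k)), v (evalNode i)) := by
    fun_prop
  exact hs.comp this

lemma evalNode_injective {n : ℕ} : Function.Injective (evalNode (n := n)) := by
  intro i j h
  simpa [evalNode, Fin.ext_iff] using h

lemma trainNode_ne_evalNode {n : ℕ} (k : Fin n) (i : Fin (n + 1)) : trainNode k ≠ evalNode i := by
  simp only [trainNode, evalNode, ne_eq, Fin.ext_iff]
  omega

lemma evalNode_last (n : ℕ) : evalNode (Fin.last n) = testNode n := by
  simp only [evalNode, testNode, Fin.ext_iff, Fin.val_last]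
  omega

lemma evalNode_castSucc {n : ℕ} (i : Fin n) : evalNode i.castSucc = validNode i := rfl

/-- A transposition of evaluation nodes fixes the training sample, so the score function itself is
unchanged. -/
lemma evalScore_swap {E : Type*} {n : ℕ} (s : (Fin n → E) → E → ℝ) (v : Fin (2 * n + 1) → E)
    (j j' i : Fin (n + 1)) :
    evalScore s (fun k => v (Equiv.swap (evalNode j) (evalNode j') k)) i =
      evalScore s v (Equiv.swap j j' i) := by
  unfold evalScore
  congr 1
  · funext k
    exact congrArg v (Equiv.swap_apply_of_ne_of_ne (trainNode_ne_evalNode k _)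
      (trainNode_ne_evalNode k _))
  · exact congrArg v (evalNode_injective.map_swap _ _ _).symm

/-- The `j`-th of the scores has fewer than `k` scores strictly below it. -/
def rankSet {E : Type*} {n : ℕ} (s : (Fin n → E) → E → ℝ) (k : ℝ) (j : Fin (n + 1)) :
    Set (Fin (2 * n + 1) → E) :=
  {v | ((Finset.univ.filter fun i => evalScore s v i < evalScore s v j).card : ℝ) < k}

lemma measurableSet_rankSet {E : Type*} [MeasurableSpace E] {n : ℕ} {s : (Fin n → E) → E → ℝ}
    (hs : Measurable (Function.uncurry s)) (k : ℝ) (j : Fin (n + 1)) :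
    MeasurableSet (rankSet s k j) :=
  measurableSet_lt (measurable_card_filter _ fun i =>
    measurableSet_lt (measurable_evalScore hs i) (measurable_evalScore hs j)) measurable_const

lemma swap_mem_rankSet_iff {E : Type*} {n : ℕ} (s : (Fin n → E) → E → ℝ) (k : ℝ)
    (j j' : Fin (n + 1)) (v : Fin (2 * n + 1) → E) :
    (fun i => v (Equiv.swap (evalNode j) (evalNode j') i)) ∈ rankSet s k j' ↔
      v ∈ rankSet s k j := by
  have hcard : (Finset.univ.filter fun i =>
      evalScore s v (Equiv.swap j j' i) < evalScore s v j).card =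
      (Finset.univ.filter fun i => evalScore s v i < evalScore s v j).card :=
    Finset.card_equiv (Equiv.swap j j') (by simp)
  simp only [rankSet, Set.mem_ofPred_eq, evalScore_swap, Equiv.swap_apply_right, hcard]

/-- Under exchangeability, the last score has a rank below `k` with probability at least
`k / (n + 1)`. -/
lemma le_measureReal_rankSet_last {E : Type*} [MeasurableSpace E] {n : ℕ}
    {s : (Fin n → E) → E → ℝ} (hs : Measurable (Function.uncurry s))
    (μ : Measure (Fin (2 * n + 1) → E)) [IsProbabilityMeasure μ]
    (hμ : ∀ σ : Equiv.Perm (Fin (2 * n + 1)), μ.map (fun v i => v (σ i)) = μ)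
    {β : ℝ} (hβ : β ≤ 1) :
    β ≤ μ.real (rankSet s (β * (n + 1)) (Fin.last n)) := by
  set k := β * ((n : ℝ) + 1) with hk
  have hn : (0 : ℝ) < (n : ℝ) + 1 := by positivity
  have hmeas := measurableSet_rankSet hs k
  have heq : ∀ j, μ.real (rankSet s k j) = μ.real (rankSet s k (Fin.last n)) := by
    intro j
    have h := hμ (Equiv.swap (evalNode j) (evalNode (Fin.last n)))
    conv_rhs => rw [← h]
    rw [measureReal_def, measureReal_def, Measure.map_apply (by fun_prop) (hmeas _)]
    congr 2
    ext v
    exact (swap_mem_rankSet_iff s k j (Fin.last n) v).symm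
  have hint : ∀ j, Integrable ((rankSet s k j).indicator (fun _ => (1 : ℝ))) μ := fun j =>
    (integrable_const (1 : ℝ)).indicator (hmeas j)
  have hsum : k ≤ ∑ j : Fin (n + 1), μ.real (rankSet s k j) := by
    calc k = ∫ _, k ∂μ := by simp
      _ ≤ ∫ v, ∑ j : Fin (n + 1), (rankSet s k j).indicator (fun _ => (1 : ℝ)) v ∂μ := by
          refine integral_mono (integrable_const _) (integrable_finsetSum _ fun j _ => hint j) ?_
          intro v
          have h := le_card_rank_lt (evalScore s v) (k := k) (by
            rw [hk, Fintype.card_fin]; push_cast; nlinarith)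
          refine h.trans (le_of_eq ?_)
          classical
          simp [Set.indicator_apply, rankSet]
      _ = ∑ j : Fin (n + 1), μ.real (rankSet s k j) := by
          rw [integral_finsetSum _ fun j _ => hint j]
          exact Finset.sum_congr rfl fun j _ => integral_indicator_one (hmeas j)
  -- All `n + 1` probabilities are equal, so `β * (n + 1)` is at most `n + 1` times the last one.
  simp only [heq, Finset.sum_const, Finset.card_univ, Fintype.card_fin, nsmul_eq_mul] at hsum
  push_cast at hsum
  exact le_of_mul_le_mul_left (by linarith) hn

lemma measurable_cdfScore {n d p : ℕ} {F : (Fin n → Triple d p) → Triple d p → ℝ}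
    (hF : Measurable (Function.uncurry F)) : Measurable (Function.uncurry (cdfScore F)) := by
  have : Function.uncurry (cdfScore F) = fun q => |1 / 2 - Function.uncurry F q| := rfl
  rw [this]
  exact (measurable_const.sub hF).abs

/-- Coverage of the test response in terms of the number of smaller validation scores. -/
lemma mem_conformalSet_iff {n d p : ℕ} (hn : 1 ≤ n) (F : (Fin n → Triple d p) → Triple d p → ℝ)
    (α : ℝ) (y : Fin (2 * n + 1) → ℝ) (x : Fin (2 * n + 1) → Fin d → ℝ)
    (zhat : Fin (2 * n + 1) → Fin p → ℝ) :
    y (testNode n) ∈ conformalSet F α y x zhat ↔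
      ((Finset.univ.filter fun i : Fin n =>
        evalScore (cdfScore F) (fun i => (y i, x i, zhat i)) i.castSucc <
          evalScore (cdfScore F) (fun i => (y i, x i, zhat i)) (Fin.last n)).card : ℝ) <
        (1 - α) * (n + 1) := by
  rw [conformalSet, splitConformalSet, Set.mem_ofPred_eq, le_conformalQuantile_iff hn]
  simp only [evalScore, evalNode_castSucc, evalNode_last]

/-- Adding the test score to the count changes nothing, as it is not strictly below itself. The
factor `1 + 1/n` in the level is what turns `n` into `n + 1`. -/
lemma mem_conformalSet_iff_mem_rankSet {n d p : ℕ} (hn : 1 ≤ n)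
    (F : (Fin n → Triple d p) → Triple d p → ℝ)
    (α : ℝ) (y : Fin (2 * n + 1) → ℝ) (x : Fin (2 * n + 1) → Fin d → ℝ)
    (zhat : Fin (2 * n + 1) → Fin p → ℝ) :
    y (testNode n) ∈ conformalSet F α y x zhat ↔
      (fun i => (y i, x i, zhat i)) ∈
        rankSet (cdfScore F) ((1 - α) * (n + 1)) (Fin.last n) := by
  rw [mem_conformalSet_iff hn, rankSet, Set.mem_ofPred_eq, Finset.card_filter, Finset.card_filter,
    Fin.sum_univ_castSucc]
  simp

section Coverage

variable {n d p : ℕ} {Ω : Type*} [MeasurableSpace Ω] {P : Measure Ω}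
  {Y : Fin (2 * n + 1) → Ω → ℝ} {X : Fin (2 * n + 1) → Ω → Fin d → ℝ}
  {ξ : Fin (2 * n + 1) → Ω → unitInterval}
  {η : Fin (2 * n + 1) → Fin (2 * n + 1) → Ω → unitInterval} {ρ : ℝ}
  {w : unitInterval → unitInterval → ℝ}
  {ζ : (Fin (2 * n + 1) → Fin (2 * n + 1) → ℝ) → (Fin (2 * n + 1) → Fin d → ℝ) →
    Fin (2 * n + 1) → Fin p → ℝ}
  {A : Ω → Fin (2 * n + 1) → Fin (2 * n + 1) → ℝ} {Zhat : Fin (2 * n + 1) → Ω → Fin p → ℝ}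
  {F : (Fin n → Triple d p) → Triple d p → ℝ} {α : ℝ}

lemma measurableSet_cover (hn : 1 ≤ n) (hF : Measurable (Function.uncurry F))
    (hV : Measurable fun ω i => ((Y i ω, X i ω, Zhat i ω) : Triple d p)) :
    MeasurableSet {ω | Y (testNode n) ω ∈
      conformalSet F α (fun i => Y i ω) (fun i => X i ω) (fun i => Zhat i ω)} := by
  have h := hV (measurableSet_rankSet (measurable_cdfScore hF) ((1 - α) * (n + 1)) (Fin.last n))
  convert h using 1
  ext ω
  simp only [Set.mem_ofPred_eq, Set.mem_preimage]
  exact mem_conformalSet_iff_mem_rankSet hn F α (fun i => Y i ω) (fun i => X i ω) fun i => Zhat i ω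

/-- Unconditional validity of split conformal prediction with network covariates. -/
theorem le_measureReal_cover [IsProbabilityMeasure P] (hn : 1 ≤ n) (hw : IsGraphon w)
    (hs : IsIndependentTriplets P Y X ξ η)
    (hA : ∀ ω, A ω = adjacency ρ w (fun i => ξ i ω) (fun i j => η i j ω))
    (hζ : Measurable (Function.uncurry ζ)) (hequiv : IsPermEquivariant P ζ A X)
    (hZhat : ∀ i ω, Zhat i ω = ζ (A ω) (fun k => X k ω) i)
    (hF : Measurable (Function.uncurry F)) (hα : 0 ≤ α) :
    1 - α ≤ P.real {ω | Y (testNode n) ω ∈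
      conformalSet F α (fun i => Y i ω) (fun i => X i ω) (fun i => Zhat i ω)} := by
  have hV := measurable_observed_triples (P := P) hw hs hA hζ hZhat
  set V := fun ω i => ((Y i ω, X i ω, Zhat i ω) : Triple d p) with hVdef
  have : IsProbabilityMeasure (P.map V) := Measure.isProbabilityMeasure_map hV.aemeasurable
  have hmeas := measurableSet_rankSet (measurable_cdfScore hF) ((1 - α) * (n + 1)) (Fin.last n)
  have hex : ∀ σ : Equiv.Perm (Fin (2 * n + 1)), (P.map V).map (fun v i => v (σ i)) = P.map V := by
    intro σ
    rw [Measure.map_map (by fun_prop) hV]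
    exact observed_exchangeable hw hs hA hζ hequiv hZhat σ
  have h := le_measureReal_rankSet_last (measurable_cdfScore hF) (P.map V) hex
    (β := 1 - α) (by linarith)
  rw [measureReal_def, Measure.map_apply hV hmeas] at h
  refine h.trans (le_of_eq (congrArg (fun s => (P s).toReal) ?_))
  ext ω
  simp only [Set.mem_ofPred_eq, Set.mem_preimage]
  exact (mem_conformalSet_iff_mem_rankSet hn F α (fun i => Y i ω) (fun i => X i ω)
    fun i => Zhat i ω).symm

end Coverage

/-! ### The probability integral transform -/

/-- The jump of the distribution function at a point is the mass of that point, so without atoms it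
is continuous and the intermediate value theorem applies. -/
lemma exists_measureReal_Iic_eq (ν : Measure ℝ) [IsProbabilityMeasure ν]
    (hν : ∀ y, ν {y} = 0) {u : ℝ} (h0 : 0 < u) (h1 : u < 1) : ∃ y, ν.real (Set.Iic y) = u := by
  have hcont : Continuous (cdf ν) := by
    refine continuous_iff_continuousAt.2 fun y => ?_
    rw [(monotone_cdf ν).continuousAt_iff_leftLim_eq_rightLim, StieltjesFunction.rightLim_eq]
    refine le_antisymm ((monotone_cdf ν).leftLim_le le_rfl) ?_
    have h := (cdf ν).measure_singleton y
    rw [measure_cdf, hν] at h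
    have := ENNReal.ofReal_eq_zero.1 h.symm
    linarith
  obtain ⟨y, hy⟩ := mem_range_of_exists_le_of_exists_ge hcont
    (((tendsto_cdf_atBot ν).eventually (gt_mem_nhds h0)).exists.imp fun _ h => le_of_lt h)
    (((tendsto_cdf_atTop ν).eventually (lt_mem_nhds h1)).exists.imp fun _ h => le_of_lt h)
  exact ⟨y, by rw [← cdf_eq_real, hy]⟩

lemma measureReal_Ioc_eq (ν : Measure ℝ) [IsProbabilityMeasure ν] {x y : ℝ} (h : x ≤ y) :
    ν.real (Set.Ioc x y) = ν.real (Set.Iic y) - ν.real (Set.Iic x) := by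
  have hset : Set.Ioc x y = Set.Iic y \ Set.Iic x := by
    ext t
    simp [and_comm]
  rw [hset, measureReal_sdiff (Set.Iic_subset_Iic.2 h) measurableSet_Iic]

/-- The distribution function of an atomless law, evaluated at a variable with this law, is
uniform. -/
lemma measureReal_cdf_mem_Icc (ν : Measure ℝ) [IsProbabilityMeasure ν]
    (hν : ∀ y, ν {y} = 0) {a b : ℝ} (ha : 0 < a) (hab : a ≤ b) (hb : b < 1) :
    ν.real {y | a ≤ ν.real (Set.Iic y) ∧ ν.real (Set.Iic y) ≤ b} = b - a := by
  have hmono : ∀ {x y : ℝ}, x ≤ y → ν.real (Set.Iic x) ≤ ν.real (Set.Iic y) := fun h =>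
    measureReal_mono (Set.Iic_subset_Iic.2 h)
  have hlt : ∀ {x y : ℝ}, ν.real (Set.Iic x) < ν.real (Set.Iic y) → x < y := fun h =>
    not_le.1 fun h' => absurd (hmono h') (not_le.2 h)
  apply le_antisymm
  -- The distribution function may have plateaus, so reaching level `a` does not place a point to
  -- the right of a chosen `a`-quantile. Slightly wider levels `a - δ` and `b + δ` restore strict
  -- inequalities.
  · refine le_of_forall_pos_le_add fun ε hε => ?_
    obtain ⟨δ, hδ0, hδε, hδa, hδb⟩ : ∃ δ : ℝ, 0 < δ ∧ 2 * δ ≤ ε ∧ δ < a ∧ b + δ < 1 := by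
      refine ⟨min (ε / 2) (min (a / 2) ((1 - b) / 2)), ?_, ?_, ?_, ?_⟩
      · exact lt_min (by linarith) (lt_min (by linarith) (by linarith))
      · linarith [min_le_left (ε / 2) (min (a / 2) ((1 - b) / 2))]
      · linarith [(min_le_right (ε / 2) (min (a / 2) ((1 - b) / 2))).trans (min_le_left _ _)]
      · linarith [(min_le_right (ε / 2) (min (a / 2) ((1 - b) / 2))).trans (min_le_right _ _)]
    obtain ⟨x, hx⟩ := exists_measureReal_Iic_eq ν hν (u := a - δ) (by linarith) (by linarith)
    obtain ⟨y, hy⟩ := exists_measureReal_Iic_eq ν hν (u := b + δ) (by linarith) (by linarith)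
    have hxy : x ≤ y := (hlt (by linarith)).le
    calc ν.real {y | a ≤ ν.real (Set.Iic y) ∧ ν.real (Set.Iic y) ≤ b}
        ≤ ν.real (Set.Ioc x y) := by
          refine measureReal_mono fun t ht => ?_
          exact ⟨hlt (by linarith [ht.1]), (hlt (by linarith [ht.2])).le⟩
      _ ≤ b - a + ε := by rw [measureReal_Ioc_eq ν hxy]; linarith
  · obtain ⟨x, hx⟩ := exists_measureReal_Iic_eq ν hν (u := a) ha (by linarith)
    obtain ⟨y, hy⟩ := exists_measureReal_Iic_eq ν hν (u := b) (by linarith) hb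
    rcases le_total x y with hxy | hxy
    · calc b - a = ν.real (Set.Ioc x y) := by rw [measureReal_Ioc_eq ν hxy]; linarith
        _ ≤ _ := by
          refine measureReal_mono fun t ht => ⟨?_, ?_⟩
          · rw [← hx]; exact hmono ht.1.le
          · rw [← hy]; exact hmono ht.2
    · have := hmono hxy
      exact le_trans (by linarith) measureReal_nonneg

/-- The distance of a uniform variable to `1/2` is uniform on `[0, 1/2]`. -/
lemma measureReal_abs_half_sub_cdf_le (ν : Measure ℝ) [IsProbabilityMeasure ν]
    (hν : ∀ y, ν {y} = 0) {t : ℝ} (h0 : 0 ≤ t) (h1 : t < 1 / 2) :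
    ν.real {y | |1 / 2 - ν.real (Set.Iic y)| ≤ t} = 2 * t := by
  have : {y | |1 / 2 - ν.real (Set.Iic y)| ≤ t} =
      {y | 1 / 2 - t ≤ ν.real (Set.Iic y) ∧ ν.real (Set.Iic y) ≤ 1 / 2 + t} := by
    ext y
    simp only [Set.mem_ofPred_eq, abs_le]
    constructor <;> rintro ⟨h, h'⟩ <;> constructor <;> linarith
  rw [this, measureReal_cdf_mem_Icc ν hν (by linarith) (by linarith) (by linarith)]
  ring

/-! ### The conditional distribution function -/

/-- The mass is that of a section of the diagonal. Joint measurability is needed to apply Fubini to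
the set of atoms. -/
lemma measurable_kernel_singleton {α : Type*} [MeasurableSpace α] (κ : Kernel α ℝ) [IsFiniteKernel κ] :
    Measurable fun q : α × ℝ => κ q.1 {q.2} := by
  have h := Kernel.measurable_kernel_prodMk_left (κ := κ.comap (Prod.fst : α × ℝ → α) measurable_fst)
    (t := {q : (α × ℝ) × ℝ | q.2 = q.1.2})
    (measurableSet_eq_fun measurable_snd (measurable_snd.comp measurable_fst))
  exact h

lemma measurable_kernel_Iic {α : Type*} [MeasurableSpace α] (κ : Kernel α ℝ) [IsFiniteKernel κ] :
    Measurable fun q : α × ℝ => (κ q.1).real (Set.Iic q.2) := by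
  have h := Kernel.measurable_kernel_prodMk_left (κ := κ.comap (Prod.fst : α × ℝ → α) measurable_fst)
    (t := {q : (α × ℝ) × ℝ | q.2 ≤ q.1.2})
    (measurableSet_le measurable_snd (measurable_snd.comp measurable_fst))
  exact h.ennreal_toReal

/-! ### Uniformity of the oracle score -/

section TrueScore

variable {d p : ℕ} {Ω : Type*} [MeasurableSpace Ω] {P : Measure Ω}
  {Y : Ω → ℝ} {X : Ω → Fin d → ℝ} {Z : Ω → Fin p → ℝ}

lemma measurable_trueCDF [IsFiniteMeasure P] : Measurable (trueCDF P Y X Z) := by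
  have h : Measurable fun v : Triple d p => ((v.2.1, v.2.2), v.1) := by fun_prop
  exact (measurable_kernel_Iic (condDistrib Y (fun ω => (X ω, Z ω)) P)).comp h

/-- If the triple has a density, then the conditional laws of the response have no atoms. -/
lemma ae_condDistrib_singleton_eq_zero [IsFiniteMeasure P] (hY : Measurable Y)
    (hX : Measurable X) (hZ : Measurable Z)
    (hcont : P.map (fun ω => (Y ω, X ω, Z ω)) ≪ volume) :
    ∀ᵐ ω ∂P, ∀ y, condDistrib Y (fun ω => (X ω, Z ω)) P (X ω, Z ω) {y} = 0 := by
  set κ := condDistrib Y (fun ω => (X ω, Z ω)) P with hκ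
  have hW : Measurable fun ω => (X ω, Z ω) := hX.prodMk hZ
  set S : Set (((Fin d → ℝ) × (Fin p → ℝ)) × ℝ) := {q | κ q.1 {q.2} ≠ 0} with hS
  have hSm : MeasurableSet S := (measurable_kernel_singleton κ) (measurableSet_singleton 0).compl
  -- Each conditional law has at most countably many atoms, so every section of `S` is Lebesgue
  -- null.
  have hvol : (volume : Measure (((Fin d → ℝ) × (Fin p → ℝ)) × ℝ)) S = 0 := by
    rw [Measure.volume_eq_prod, Measure.measure_prod_null hSm]
    refine Eventually.of_forall fun a => Set.Countable.measure_zero ?_ _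
    have := Measure.countable_meas_pos_of_disjoint_iUnion (μ := κ a) (As := fun y : ℝ => {y})
      (fun y => measurableSet_singleton y) (fun x y hxy => by simpa [Function.onFun] using hxy)
    refine Set.Countable.mono (fun y hy => ?_) this
    exact pos_iff_ne_zero.2 hy
  have hswap : P.map (fun ω => ((X ω, Z ω), Y ω)) ≪ volume := by
    have h := hcont.map (f := Prod.swap) measurable_swap
    rw [Measure.map_map measurable_swap (hY.prodMk hW), Measure.volume_eq_prod,
      Measure.prod_swap, ← Measure.volume_eq_prod] at h
    exact h
  have h0 : (P.map (fun ω => (X ω, Z ω)) ⊗ₘ κ) S = 0 := by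
    rw [hκ, compProd_map_condDistrib hY.aemeasurable]
    exact hswap hvol
  have h1 := (Measure.ae_compProd_iff (μ := P.map (fun ω => (X ω, Z ω))) (κ := κ)
    (p := fun q => ¬ q ∈ S) hSm.compl).1 (measure_eq_zero_iff_ae_notMem.1 h0)
  filter_upwards [ae_of_ae_map hW.aemeasurable h1] with ω hω y
  by_contra hy
  have h2 : κ (X ω, Z ω) {y} ≤ κ (X ω, Z ω) {b | ¬ ¬ ((X ω, Z ω), b) ∈ S} := by
    refine measure_mono ?_
    rintro b rfl
    simpa [hS] using hy
  exact hy (le_antisymm (h2.trans (le_of_eq (ae_iff.1 hω))) bot_le)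

/-- The score of the true conditional distribution function. -/
noncomputable def trueScore (P : Measure Ω) [IsFiniteMeasure P] (Y : Ω → ℝ) (X : Ω → Fin d → ℝ)
    (Z : Ω → Fin p → ℝ) (v : Triple d p) : ℝ :=
  |1 / 2 - trueCDF P Y X Z v|

lemma measurable_trueScore [IsFiniteMeasure P] : Measurable (trueScore P Y X Z) :=
  (measurable_const.sub measurable_trueCDF).abs

/-- Given the covariates, the true score is uniform on `[0, 1/2]`. -/
lemma condExp_trueScore_le [IsProbabilityMeasure P] (hY : Measurable Y)
    (hX : Measurable X) (hZ : Measurable Z)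
    (hcont : P.map (fun ω => (Y ω, X ω, Z ω)) ≪ volume) {t : ℝ} (h0 : 0 ≤ t) (h1 : t < 1 / 2) :
    P⟦{ω | trueScore P Y X Z (Y ω, X ω, Z ω) ≤ t} |
      MeasurableSpace.comap (fun ω => (X ω, Z ω)) inferInstance⟧ =ᵐ[P] fun _ => 2 * t := by
  set κ := condDistrib Y (fun ω => (X ω, Z ω)) P with hκ
  have hW : Measurable fun ω => (X ω, Z ω) := hX.prodMk hZ
  set S : Set (((Fin d → ℝ) × (Fin p → ℝ)) × ℝ) :=
    {q | |1 / 2 - (κ q.1).real (Set.Iic q.2)| ≤ t} with hS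
  have hSm : MeasurableSet S :=
    measurableSet_le (measurable_const.sub (measurable_kernel_Iic κ)).abs measurable_const
  have h := condExp_prod_ae_eq_integral_condDistrib (μ := P) (X := fun ω => (X ω, Z ω)) (Y := Y)
    (f := S.indicator fun _ => (1 : ℝ)) hW hY.aemeasurable
    (stronglyMeasurable_const.indicator hSm)
    ((integrable_const (1 : ℝ)).indicator ((hW.prodMk hY) hSm))
  refine h.trans ?_
  filter_upwards [ae_condDistrib_singleton_eq_zero hY hX hZ hcont] with ω hω
  have hset : (fun y => S.indicator (fun _ => (1 : ℝ)) ((X ω, Z ω), y)) =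
      ({y | |1 / 2 - (κ (X ω, Z ω)).real (Set.Iic y)| ≤ t}).indicator 1 := rfl
  have hm : MeasurableSet {y | |1 / 2 - (κ (X ω, Z ω)).real (Set.Iic y)| ≤ t} :=
    hSm.preimage measurable_prodMk_left
  rw [hset, integral_indicator_one hm, measureReal_abs_half_sub_cdf_le _ hω h0 h1]

lemma measureReal_trueScore_le [IsProbabilityMeasure P] (hY : Measurable Y)
    (hX : Measurable X) (hZ : Measurable Z)
    (hcont : P.map (fun ω => (Y ω, X ω, Z ω)) ≪ volume) {t : ℝ} (h0 : 0 ≤ t) (h1 : t < 1 / 2) :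
    P.real {ω | trueScore P Y X Z (Y ω, X ω, Z ω) ≤ t} = 2 * t := by
  have hm : MeasurableSet {ω | trueScore P Y X Z (Y ω, X ω, Z ω) ≤ t} :=
    measurableSet_le (measurable_trueScore.comp (hY.prodMk (hX.prodMk hZ))) measurable_const
  rw [← integral_indicator_one hm]
  have h := integral_congr_ae (condExp_trueScore_le hY hX hZ hcont h0 h1)
  rw [integral_condExp (hX.prodMk hZ).comap_le] at h
  refine h.trans ?_
  simp

end TrueScore

/-! ### Coverage of the estimated scores and of the true scores -/

/-- If most of the scores `S i` are close to `T i`, if `s` is close to `t`, and if the empirical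
distribution of `T` is close to the uniform distribution on `[0, 1/2]` around `β / 2`, then `s` has
a small rank among the `S i` iff `t ≤ β / 2`, unless `t` is close to `β / 2`. -/
lemma card_lt_iff_of_close {n : ℕ} {S T : Fin n → ℝ} {s t β δ : ℝ} (hβ : 0 < β)
    (hδ : 0 < δ) (hn : β ≤ n * δ) (hst : |s - t| ≤ δ)
    (hbad : ((Finset.univ.filter fun i => δ < |S i - T i|).card : ℝ) ≤ n * (δ / 2))
    (hup : |((Finset.univ.filter fun i => T i ≤ β / 2 + δ).card : ℝ) - n * (2 * (β / 2 + δ))| <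
      n * (δ / 2))
    (hlow : |((Finset.univ.filter fun i => T i ≤ β / 2 - δ).card : ℝ) - n * (2 * (β / 2 - δ))| <
      n * (δ / 2))
    (ht : 3 * δ < |t - β / 2|) :
    ((Finset.univ.filter fun i => S i < s).card : ℝ) < β * (n + 1) ↔ t ≤ β / 2 := by
  classical
  have hst' := abs_le.1 hst
  have hup' := abs_lt.1 hup
  have hlow' := abs_lt.1 hlow
  rcases lt_abs.1 ht with h | h
  -- Here `s > β/2 + 2δ`, so each good index with `T i ≤ β/2 + δ` is counted. The count exceeds `n(β
  -- + 2δ) - nδ/2 - nδ/2 = n(β + δ)`, and `nδ ≥ β` absorbs the extra `β`.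
  · refine iff_of_false (not_lt.2 ?_) (by linarith)
    have hsub : (Finset.univ.filter fun i => T i ≤ β / 2 + δ) ⊆
        (Finset.univ.filter fun i => S i < s) ∪
          (Finset.univ.filter fun i => δ < |S i - T i|) := by
      intro i hi
      replace hi := (Finset.mem_filter.1 hi).2
      by_cases hb : δ < |S i - T i|
      · exact Finset.mem_union_right _ (by simpa using hb)
      · refine Finset.mem_union_left _ ?_
        have := (abs_le.1 (not_lt.1 hb)).2
        simp only [Finset.mem_filter, Finset.mem_univ, true_and]
        linarith
    have hcard : ((Finset.univ.filter fun i => T i ≤ β / 2 + δ).card : ℝ) ≤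
        ((Finset.univ.filter fun i => S i < s).card : ℝ) +
          ((Finset.univ.filter fun i => δ < |S i - T i|).card : ℝ) := by
      exact_mod_cast (Finset.card_le_card hsub).trans (Finset.card_union_le _ _)
    nlinarith
  -- Symmetrically, `s < β/2 - 2δ` leaves fewer than `n(β - δ)` counted indices.
  · refine iff_of_true ?_ (by linarith)
    have hsub : (Finset.univ.filter fun i => S i < s) ⊆
        (Finset.univ.filter fun i => T i ≤ β / 2 - δ) ∪
          (Finset.univ.filter fun i => δ < |S i - T i|) := by
      intro i hi
      replace hi := (Finset.mem_filter.1 hi).2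
      by_cases hb : δ < |S i - T i|
      · exact Finset.mem_union_right _ (by simpa using hb)
      · refine Finset.mem_union_left _ ?_
        have := (abs_le.1 (not_lt.1 hb)).1
        simp only [Finset.mem_filter, Finset.mem_univ, true_and]
        linarith
    have hcard : ((Finset.univ.filter fun i => S i < s).card : ℝ) ≤
        ((Finset.univ.filter fun i => T i ≤ β / 2 - δ).card : ℝ) +
          ((Finset.univ.filter fun i => δ < |S i - T i|).card : ℝ) := by
      exact_mod_cast (Finset.card_le_card hsub).trans (Finset.card_union_le _ _)
    nlinarith

/-! ### Concentration of counts and the exceptional events -/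

section Probability

variable {Ω : Type*} [MeasurableSpace Ω] {P : Measure Ω}

/-- Chebyshev's inequality for the number of independent variables below a threshold. -/
lemma measure_card_le_sub_ge [IsProbabilityMeasure P] {n : ℕ} (hn : 1 ≤ n) {T : Fin n → Ω → ℝ}
    (hT : ∀ i, Measurable (T i)) (hind : iIndepFun T P) {u π ε : ℝ}
    (hπ : ∀ i, P.real {ω | T i ω ≤ u} = π) (hε : 0 < ε) :
    P {ω | n * ε ≤ |((Finset.univ.filter fun i => T i ω ≤ u).card : ℝ) - n * π|} ≤
      ENNReal.ofReal (1 / (n * ε ^ 2)) := by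
  have hn' : (0 : ℝ) < n := by exact_mod_cast hn
  set g : ℝ → ℝ := (Set.Iic u).indicator 1 with hg
  have hgm : Measurable g := measurable_one.indicator measurableSet_Iic
  have hg01 : ∀ x, g x ∈ Set.Icc (0 : ℝ) 1 := fun x => by
    by_cases hx : x ≤ u <;> simp [hg, hx]
  have hXm : ∀ i, Measurable (g ∘ T i) := fun i => hgm.comp (hT i)
  have hXL : ∀ i, MemLp (g ∘ T i) 2 P := fun i =>
    MemLp.of_bound (hXm i).aestronglyMeasurable 1 (Eventually.of_forall fun ω => by
      have := hg01 (T i ω)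
      rw [Real.norm_eq_abs, abs_le]
      exact ⟨le_trans (by norm_num) this.1, this.2⟩)
  have hcard : ∀ ω, (∑ i, g ∘ T i) ω = ((Finset.univ.filter fun i => T i ω ≤ u).card : ℝ) := by
    intro ω
    simp [hg, Set.indicator_apply]
  have hmean : ∫ ω, (∑ i, g ∘ T i) ω ∂P = n * π := by
    simp only [Finset.sum_apply]
    rw [integral_finsetSum _ fun i _ => (hXL i).integrable (by norm_num)]
    have : ∀ i, ∫ ω, (g ∘ T i) ω ∂P = π := fun i => by
      rw [← hπ i, ← integral_indicator_one (measurableSet_le (hT i) measurable_const)]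
      rfl
    simp only [this, Finset.sum_const, Finset.card_univ, Fintype.card_fin, nsmul_eq_mul]
  -- The crude bound one on the variance of an indicator suffices, since only the order `1/n`
  -- matters.
  have hvar : Var[∑ i, g ∘ T i; P] ≤ n := by
    rw [IndepFun.variance_sum (fun i _ => hXL i)
      (fun i _ j _ hij => (hind.comp (fun _ => g) fun _ => hgm).indepFun hij)]
    calc ∑ i, Var[g ∘ T i; P] ≤ ∑ _i : Fin n, (1 : ℝ) := by
          refine Finset.sum_le_sum fun i _ => ?_
          refine (variance_le_sq_of_bounded (a := 0) (b := 1)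
            (Eventually.of_forall fun ω => hg01 (T i ω)) (hXm i).aemeasurable).trans ?_
          norm_num
      _ = n := by simp
  have h := meas_ge_le_variance_div_sq (memLp_finsetSum' Finset.univ fun i _ => hXL i)
    (c := n * ε) (by positivity)
  rw [hmean] at h
  simp only [hcard] at h
  refine h.trans (ENNReal.ofReal_le_ofReal ?_)
  rw [div_le_div_iff₀ (by positivity) (by positivity)]
  nlinarith [mul_le_mul_of_nonneg_right hvar (by positivity : (0 : ℝ) ≤ n * ε ^ 2)]

/-- Markov's inequality for the number of variables that exceed a threshold. -/
lemma measure_lt_card_le {n : ℕ} (hn : 1 ≤ n) {D : Fin n → Ω → ℝ}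
    (hD : ∀ i, Measurable (D i)) {c : ENNReal}
    (hc : ∀ i, ∫⁻ ω, ENNReal.ofReal (D i ω) ∂P ≤ c) {a b : ℝ} (ha : 0 < a) (hb : 0 < b) :
    P {ω | n * b < ((Finset.univ.filter fun i => a < D i ω).card : ℝ)} ≤
      c / ENNReal.ofReal (a * b) := by
  have hn' : (0 : ℝ) < n := by exact_mod_cast hn
  -- Each counted index contributes more than `a` to the sum. Only first moments enter, so the `D i`
  -- may be dependent, as errors sharing a training sample are.
  have hsub : {ω | n * b < ((Finset.univ.filter fun i => a < D i ω).card : ℝ)} ⊆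
      {ω | ENNReal.ofReal (n * (a * b)) ≤ ∑ i, ENNReal.ofReal (D i ω)} := by
    intro ω hω
    simp only [Set.mem_ofPred_eq] at hω ⊢
    calc ENNReal.ofReal (n * (a * b))
        ≤ ENNReal.ofReal (((Finset.univ.filter fun i => a < D i ω).card : ℝ) * a) :=
          ENNReal.ofReal_le_ofReal (by nlinarith)
      _ = ∑ _i ∈ Finset.univ.filter (fun i => a < D i ω), ENNReal.ofReal a := by
          rw [Finset.sum_const, nsmul_eq_mul, ENNReal.ofReal_mul (by positivity),
            ENNReal.ofReal_natCast]
      _ ≤ ∑ i ∈ Finset.univ.filter (fun i => a < D i ω), ENNReal.ofReal (D i ω) :=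
          Finset.sum_le_sum fun i hi => ENNReal.ofReal_le_ofReal (Finset.mem_filter.1 hi).2.le
      _ ≤ ∑ i, ENNReal.ofReal (D i ω) :=
          Finset.sum_le_sum_of_subset (Finset.filter_subset _ _)
  have hDm : ∀ i, Measurable fun ω => ENNReal.ofReal (D i ω) := fun i => (hD i).ennreal_ofReal
  calc _ ≤ P {ω | ENNReal.ofReal (n * (a * b)) ≤ ∑ i, ENNReal.ofReal (D i ω)} := measure_mono hsub
    _ ≤ (∫⁻ ω, ∑ i, ENNReal.ofReal (D i ω) ∂P) / ENNReal.ofReal (n * (a * b)) :=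
        meas_ge_le_lintegral_div (Finset.measurable_sum _ fun i _ => hDm i).aemeasurable
          (ENNReal.ofReal_pos.2 (by positivity)).ne' ENNReal.ofReal_ne_top
    _ ≤ (n * c) / (n * ENNReal.ofReal (a * b)) := by
        rw [lintegral_finsetSum _ fun i _ => hDm i, ENNReal.ofReal_mul hn'.le,
          ENNReal.ofReal_natCast]
        gcongr
        calc ∑ i, ∫⁻ ω, ENNReal.ofReal (D i ω) ∂P ≤ ∑ _i : Fin n, c :=
              Finset.sum_le_sum fun i _ => hc i
          _ = n * c := by simp
    _ = c / ENNReal.ofReal (a * b) :=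
        ENNReal.mul_div_mul_left _ _ (by simpa using (Nat.one_le_iff_ne_zero.1 hn))
          (ENNReal.natCast_ne_top n)

/-- Coverage based on the scores `S i`, `s` differs from coverage based on the true scores
`T i`, `t` with small probability. -/
lemma measure_coverage_ne_le [IsProbabilityMeasure P] {n : ℕ} (hn : 1 ≤ n)
    {S T D : Fin n → Ω → ℝ} {s t D' : Ω → ℝ}
    (hT : ∀ i, Measurable (T i)) (ht : Measurable t) (hD : ∀ i, Measurable (D i))
    (hD' : Measurable D') (hind : iIndepFun T P)
    (hTu : ∀ i u, 0 ≤ u → u < 1 / 2 → P.real {ω | T i ω ≤ u} = 2 * u)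
    (htu : ∀ u, 0 ≤ u → u < 1 / 2 → P.real {ω | t ω ≤ u} = 2 * u) {c : ENNReal}
    (hc : ∀ i, ∫⁻ ω, ENNReal.ofReal (D i ω) ∂P ≤ c) (hc' : ∫⁻ ω, ENNReal.ofReal (D' ω) ∂P ≤ c)
    {β δ : ℝ} (hδ : 0 < δ) (hlow : 0 < β / 2 - 4 * δ) (hup : β / 2 + 4 * δ < 1 / 2)
    (hnδ : β ≤ n * δ) {B : Set Ω}
    (hS : ∀ ω ∉ B, ∀ i, |S i ω - T i ω| ≤ 2 * (δ / 3) + D i ω)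
    (hs : ∀ ω ∉ B, |s ω - t ω| ≤ 2 * (δ / 3) + D' ω) :
    P {ω | ¬ (((Finset.univ.filter fun i => S i ω < s ω).card : ℝ) < β * (n + 1) ↔
        t ω ≤ β / 2)} ≤
      ENNReal.ofReal (14 * δ) + (P B + (c / ENNReal.ofReal (δ / 3) +
        (c / ENNReal.ofReal (δ / 3 * (δ / 2)) + (ENNReal.ofReal (1 / (n * (δ / 2) ^ 2)) +
          ENNReal.ofReal (1 / (n * (δ / 2) ^ 2)))))) := by
  have hsub : {ω | ¬ (((Finset.univ.filter fun i => S i ω < s ω).card : ℝ) < β * (n + 1) ↔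
        t ω ≤ β / 2)} ⊆
      {ω | |t ω - β / 2| ≤ 3 * δ} ∪ (B ∪ ({ω | ENNReal.ofReal (δ / 3) ≤ ENNReal.ofReal (D' ω)} ∪
        ({ω | n * (δ / 2) < ((Finset.univ.filter fun i => δ / 3 < D i ω).card : ℝ)} ∪
          ({ω | n * (δ / 2) ≤ |((Finset.univ.filter fun i => T i ω ≤ β / 2 + δ).card : ℝ) -
              n * (2 * (β / 2 + δ))|} ∪
            {ω | n * (δ / 2) ≤ |((Finset.univ.filter fun i => T i ω ≤ β / 2 - δ).card : ℝ) -
              n * (2 * (β / 2 - δ))|})))) := by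
    -- Off the exceptional events the comparison of ranks is deterministic; the error `D` takes the
    -- last third of the tolerance `δ`.
    intro ω hω
    by_contra hcon
    simp only [Set.mem_union, Set.mem_ofPred_eq, not_or, not_le, not_lt] at hcon
    obtain ⟨h1, hB, h2, h3, h4, h5⟩ := hcon
    have h2' : D' ω < δ / 3 := by
      by_contra h
      exact absurd (ENNReal.ofReal_le_ofReal (not_lt.1 h)) (not_le.2 h2)
    refine hω (card_lt_iff_of_close (S := fun i => S i ω) (T := fun i => T i ω) (by linarith) hδ hnδ
      ?_ ?_ h4 h5 h1)
    · linarith [hs ω hB]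
    · refine le_trans (Nat.cast_le.2 (Finset.card_le_card fun i hi => ?_)) h3
      have hi' := (Finset.mem_filter.1 hi).2
      refine Finset.mem_filter.2 ⟨Finset.mem_univ i, ?_⟩
      linarith [hS ω hB i]
  have hnear : P {ω | |t ω - β / 2| ≤ 3 * δ} ≤ ENNReal.ofReal (14 * δ) := by
    -- The lower end is moved to `4δ` so that the left endpoint is kept; the interval has length
    -- `7δ` and the density is `2`.
    have hss : {ω | |t ω - β / 2| ≤ 3 * δ} ⊆
        {ω | t ω ≤ β / 2 + 3 * δ} \ {ω | t ω ≤ β / 2 - 4 * δ} := by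
      intro ω hω
      have := abs_le.1 (show |t ω - β / 2| ≤ 3 * δ from hω)
      exact ⟨show t ω ≤ _ by linarith, show ¬ t ω ≤ _ by linarith⟩
    have hmono : {ω | t ω ≤ β / 2 - 4 * δ} ⊆ {ω | t ω ≤ β / 2 + 3 * δ} := fun ω hω =>
      show t ω ≤ _ by linarith [show t ω ≤ β / 2 - 4 * δ from hω]
    have hreal : P.real ({ω | t ω ≤ β / 2 + 3 * δ} \ {ω | t ω ≤ β / 2 - 4 * δ}) = 14 * δ := by
      rw [measureReal_sdiff hmono (measurableSet_le ht measurable_const),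
        htu _ (by linarith) (by linarith), htu _ (by linarith) (by linarith)]
      ring
    rw [← hreal, ofReal_measureReal]
    exact measure_mono hss
  refine (measure_mono hsub).trans ((measure_union_le _ _).trans (add_le_add hnear ?_))
  refine (measure_union_le _ _).trans (add_le_add le_rfl ?_)
  refine (measure_union_le _ _).trans (add_le_add ?_ ?_)
  · refine (meas_ge_le_lintegral_div hD'.ennreal_ofReal.aemeasurable
      (by simpa using hδ) ENNReal.ofReal_ne_top).trans ?_
    gcongr
  refine (measure_union_le _ _).trans (add_le_add ?_ ?_)
  · exact measure_lt_card_le hn hD hc (by positivity) (by positivity)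
  refine (measure_union_le _ _).trans (add_le_add ?_ ?_)
  · exact measure_card_le_sub_ge hn hT hind (fun i => hTu i _ (by linarith) (by linarith))
      (by positivity)
  · exact measure_card_le_sub_ge hn hT hind (fun i => hTu i _ (by linarith) (by linarith))
      (by positivity)

end Probability

/-- If the conditional probability of `B` is the constant `b`, then that of `C` is close to `b` as
soon as the probability that exactly one of `B`, `C` occurs is small. -/
lemma measure_condExp_sub_le {Ω : Type*} {m m0 : MeasurableSpace Ω} {P : Measure Ω}
    [IsProbabilityMeasure P] {B C : Set Ω} (hB : MeasurableSet B)
    (hC : MeasurableSet C) {b : ℝ} (hb : P⟦B | m⟧ =ᵐ[P] fun _ => b) {ε : ℝ} (hε : 0 < ε) :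
    P {ω | ε < |(P⟦C | m⟧) ω - b|} ≤ P {ω | ¬ (ω ∈ C ↔ ω ∈ B)} / ENNReal.ofReal ε := by
  have hiB : Integrable (B.indicator fun _ => (1 : ℝ)) P := (integrable_const _).indicator hB
  have hiC : Integrable (C.indicator fun _ => (1 : ℝ)) P := (integrable_const _).indicator hC
  set f : Ω → ℝ := (C.indicator fun _ => (1 : ℝ)) - B.indicator fun _ => (1 : ℝ) with hf
  have hsub : (P[f | m]) =ᵐ[P] fun ω => (P⟦C | m⟧) ω - b := by
    refine (condExp_sub hiC hiB m).trans ?_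
    filter_upwards [hb] with ω hω
    simp only [Pi.sub_apply, hω]
  have hset : P {ω | ε < |(P⟦C | m⟧) ω - b|} ≤ P {ω | ENNReal.ofReal ε ≤ ‖(P[f | m]) ω‖ₑ} := by
    refine measure_mono_ae ?_
    filter_upwards [hsub] with ω hω h
    show ENNReal.ofReal ε ≤ ‖(P[f | m]) ω‖ₑ
    rw [hω, Real.enorm_eq_ofReal_abs]
    exact ENNReal.ofReal_le_ofReal (le_of_lt h)
  have hD : MeasurableSet {ω | ¬ (ω ∈ C ↔ ω ∈ B)} := (hC.iff hB).compl
  refine hset.trans ((meas_ge_le_lintegral_div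
    (integrable_condExp.aestronglyMeasurable.enorm) (by simpa using hε)
    ENNReal.ofReal_ne_top).trans ?_)
  gcongr
  -- After Markov's inequality, `L¹` contraction bounds the conditional difference by the
  -- probability of the symmetric difference.
  have h1 := eLpNorm_condExp_le_eLpNorm (m := m) (μ := P) f le_rfl
  rw [eLpNorm_one_eq_lintegral_enorm, eLpNorm_one_eq_lintegral_enorm] at h1
  refine h1.trans (le_of_eq ?_)
  rw [← lintegral_indicator_one hD]
  refine lintegral_congr fun ω => ?_
  by_cases h : ω ∈ C <;> by_cases h' : ω ∈ B <;> simp [hf, h, h']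

/-- A telescoping bound by the largest increment. -/
lemma abs_sub_le_mul_iSup {n : ℕ} {ι : Type*} [Finite ι] (f : ℕ → ι → ℝ) (i : ι) :
    |f n i - f 0 i| ≤ n * ⨆ r : Fin n, ⨆ i, |f (r + 1) i - f r i| := by
  have hinc : ∀ r ∈ Finset.range n, |f (r + 1) i - f r i| ≤
      ⨆ r : Fin n, ⨆ i, |f (r + 1) i - f r i| := by
    intro r hr
    refine (le_ciSup (f := fun i => |f (r + 1) i - f r i|) (Set.finite_range _).bddAbove i).trans ?_
    exact le_ciSup (f := fun r : Fin n => ⨆ i, |f (r + 1) i - f r i|)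
      (Set.finite_range _).bddAbove ⟨r, Finset.mem_range.1 hr⟩
  calc |f n i - f 0 i| = |∑ r ∈ Finset.range n, (f (r + 1) i - f r i)| := by
        rw [Finset.sum_range_sub fun r => f r i]
    _ ≤ ∑ r ∈ Finset.range n, |f (r + 1) i - f r i| := Finset.abs_sum_le_sum_abs _ _
    _ ≤ ∑ _r ∈ Finset.range n, ⨆ r : Fin n, ⨆ i, |f (r + 1) i - f r i| := Finset.sum_le_sum hinc
    _ = _ := by simp

/-! ### Comparison with the oracle at a fixed sample size -/

section FixedSize

variable {n d p : ℕ} {Ω : Type*} [MeasurableSpace Ω] {P : Measure Ω} [IsProbabilityMeasure P]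
  {Y : Fin (2 * n + 1) → Ω → ℝ} {X : Fin (2 * n + 1) → Ω → Fin d → ℝ}
  {Z Zhat : Fin (2 * n + 1) → Ω → Fin p → ℝ} {F : (Fin n → Triple d p) → Triple d p → ℝ}

/-- The error of the estimator trained on i.i.d. triples has the same mean at all the nodes outside
the training sample. -/
lemma lintegral_estimation_error_eq (hY : ∀ i, Measurable (Y i)) (hX : ∀ i, Measurable (X i))
    (hZ : ∀ i, Measurable (Z i)) (hiid : IsIID (fun i ω => (Y i ω, X i ω, Z i ω)) P)
    (hF : Measurable (Function.uncurry F)) {G : Triple d p → ℝ} (hG : Measurable G)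
    (i j : Fin (n + 1)) :
    ∫⁻ ω, ENNReal.ofReal |F (fun k => (Y (trainNode k) ω, X (trainNode k) ω, Z (trainNode k) ω))
        (Y (evalNode i) ω, X (evalNode i) ω, Z (evalNode i) ω)
        - G (Y (evalNode i) ω, X (evalNode i) ω, Z (evalNode i) ω)| ∂P =
      ∫⁻ ω, ENNReal.ofReal |F (fun k => (Y (trainNode k) ω, X (trainNode k) ω, Z (trainNode k) ω))
        (Y (evalNode j) ω, X (evalNode j) ω, Z (evalNode j) ω)
        - G (Y (evalNode j) ω, X (evalNode j) ω, Z (evalNode j) ω)| ∂P := by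
  set V : Fin (2 * n + 1) → Ω → Triple d p := fun i ω => (Y i ω, X i ω, Z i ω) with hV
  have hVm : ∀ i, Measurable (V i) := fun i => (hY i).prodMk ((hX i).prodMk (hZ i))
  set H : (Fin (2 * n + 1) → Triple d p) → ENNReal := fun v =>
    ENNReal.ofReal |evalScore F v i - G (v (evalNode i))| with hH
  have hHm : Measurable H :=
    ((measurable_evalScore hF i).sub (hG.comp (measurable_pi_apply _))).abs.ennreal_ofReal
  set σ := Equiv.swap (evalNode i) (evalNode j) with hσ
  -- Exchanging the two evaluation nodes preserves the i.i.d. law and the training sample.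
  have h := congrArg (fun μ => ∫⁻ v, H v ∂μ) (hiid.map_perm hVm σ)
  beta_reduce at h
  rw [lintegral_map hHm (measurable_pi_lambda _ fun k => hVm (σ k)),
    lintegral_map hHm (measurable_pi_lambda _ hVm)] at h
  refine h.symm.trans (lintegral_congr fun ω => ?_)
  have h1 := evalScore_swap F (fun k => V k ω) i j i
  rw [Equiv.swap_apply_left] at h1
  show ENNReal.ofReal |evalScore F (fun k => V (σ k) ω) i - G (V (σ (evalNode i)) ω)| = _
  rw [hσ, h1, Equiv.swap_apply_left]
  rfl

/-- The true score at each node is uniform on `[0, 1/2]`. -/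
lemma measureReal_trueScore_le_of_iid (hY : ∀ i, Measurable (Y i)) (hX : ∀ i, Measurable (X i))
    (hZ : ∀ i, Measurable (Z i)) (hiid : IsIID (fun i ω => (Y i ω, X i ω, Z i ω)) P)
    (j : Fin (2 * n + 1)) (hcont : P.map (fun ω => (Y j ω, X j ω, Z j ω)) ≪ volume)
    (i : Fin (2 * n + 1)) {u : ℝ} (h0 : 0 ≤ u) (h1 : u < 1 / 2) :
    P.real {ω | trueScore P (Y j) (X j) (Z j) (Y i ω, X i ω, Z i ω) ≤ u} = 2 * u := by
  rw [← measureReal_trueScore_le (hY j) (hX j) (hZ j) hcont h0 h1, measureReal_def, measureReal_def]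
  congr 1
  exact (hiid.identDistrib i j).measure_mem_eq
    (s := {v | trueScore P (Y j) (X j) (Z j) v ≤ u})
    (measurableSet_le measurable_trueScore measurable_const)

lemma mixedSample_eq (y : Fin (2 * n + 1) → ℝ) (x : Fin (2 * n + 1) → Fin d → ℝ)
    (z zhat : Fin (2 * n + 1) → Fin p → ℝ) :
    mixedSample n y x z zhat = fun k => (y (trainNode k), x (trainNode k), z (trainNode k)) := by
  funext k
  simp [mixedSample]

lemma mixedSample_zero (y : Fin (2 * n + 1) → ℝ) (x : Fin (2 * n + 1) → Fin d → ℝ)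
    (z zhat : Fin (2 * n + 1) → Fin p → ℝ) :
    mixedSample 0 y x z zhat =
      fun k => (y (trainNode k), x (trainNode k), zhat (trainNode k)) := by
  funext k
  simp [mixedSample]

/-- Coverage by the conformal set differs from coverage by the oracle set with small
probability. -/
lemma measure_cover_ne_oracle_le (hn : 1 ≤ n) (hY : ∀ i, Measurable (Y i))
    (hX : ∀ i, Measurable (X i)) (hZ : ∀ i, Measurable (Z i))
    (hiid : IsIID (fun i ω => (Y i ω, X i ω, Z i ω)) P)
    (hcont : P.map (fun ω => (Y (testNode n) ω, X (testNode n) ω, Z (testNode n) ω)) ≪ volume)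
    (hF : Measurable (Function.uncurry F)) {Fr : ℕ → Ω → Triple d p → ℝ}
    (hFr : ∀ r ω, Fr r ω = F (mixedSample r (fun i => Y i ω) (fun i => X i ω)
      (fun i => Z i ω) (fun i => Zhat i ω)))
    {α δ : ℝ} (hδ : 0 < δ) (hlow : 0 < (1 - α) / 2 - 4 * δ)
    (hup : (1 - α) / 2 + 4 * δ < 1 / 2) (hnδ : 1 - α ≤ n * δ) :
    P {ω | ¬ (Y (testNode n) ω ∈ conformalSet F α (fun i => Y i ω) (fun i => X i ω)
          (fun i => Zhat i ω) ↔
        trueScore P (Y (testNode n)) (X (testNode n)) (Z (testNode n))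
          (Y (testNode n) ω, X (testNode n) ω, Z (testNode n) ω) ≤ (1 - α) / 2)} ≤
      ENNReal.ofReal (14 * δ) +
      ((P {ω | δ / 3 * (1 / (n : ℝ)) < |(⨆ r : Fin n, ⨆ i : Fin (n + 1),
          |Fr (r + 1) ω (Y (evalNode i) ω, X (evalNode i) ω, Z (evalNode i) ω)
            - Fr r ω (Y (evalNode i) ω, X (evalNode i) ω, Z (evalNode i) ω)|)|} +
        P {ω | δ / 3 * 1 < |(⨆ i : Fin (n + 1),
          |Fr 0 ω (Y (evalNode i) ω, X (evalNode i) ω, Zhat (evalNode i) ω)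
            - Fr 0 ω (Y (evalNode i) ω, X (evalNode i) ω, Z (evalNode i) ω)|)|}) +
        ((∫⁻ ω, ENNReal.ofReal
          |Fr n ω (Y (testNode n) ω, X (testNode n) ω, Z (testNode n) ω)
            - trueCDF P (Y (testNode n)) (X (testNode n)) (Z (testNode n))
              (Y (testNode n) ω, X (testNode n) ω, Z (testNode n) ω)| ∂P) / ENNReal.ofReal (δ / 3) +
        ((∫⁻ ω, ENNReal.ofReal
          |Fr n ω (Y (testNode n) ω, X (testNode n) ω, Z (testNode n) ω)
            - trueCDF P (Y (testNode n)) (X (testNode n)) (Z (testNode n))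
              (Y (testNode n) ω, X (testNode n) ω, Z (testNode n) ω)| ∂P) /
                ENNReal.ofReal (δ / 3 * (δ / 2)) +
        (ENNReal.ofReal (1 / (n * (δ / 2) ^ 2)) +
          ENNReal.ofReal (1 / (n * (δ / 2) ^ 2)))))) := by
  have hn' : (0 : ℝ) < n := by exact_mod_cast hn
  set V : Fin (2 * n + 1) → Ω → Triple d p := fun i ω => (Y i ω, X i ω, Z i ω) with hV
  have hVm : ∀ i, Measurable (V i) := fun i => (hY i).prodMk ((hX i).prodMk (hZ i))
  set U := trueCDF P (Y (testNode n)) (X (testNode n)) (Z (testNode n)) with hU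
  have hUm : Measurable U := measurable_trueCDF
  set T : Triple d p → ℝ := trueScore P (Y (testNode n)) (X (testNode n)) (Z (testNode n)) with hT
  have hTm : Measurable T := measurable_trueScore
  set S : Fin (n + 1) → Ω → ℝ := fun i ω =>
    evalScore (cdfScore F) (fun i => (Y i ω, X i ω, Zhat i ω)) i with hS
  set D : Fin (n + 1) → Ω → ℝ := fun i ω =>
    |Fr n ω (V (evalNode i) ω) - U (V (evalNode i) ω)| with hD
  have hFrn : ∀ ω, Fr n ω = F fun k => V (trainNode k) ω := fun ω => by
    rw [hFr, mixedSample_eq]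
  have hDm : ∀ i, Measurable (D i) := fun i => by
    simp only [hD, hFrn]
    have h : Measurable fun ω => ((fun k => V (trainNode k) ω), V (evalNode i) ω) :=
      (measurable_pi_lambda _ fun k => hVm (trainNode k)).prodMk (hVm (evalNode i))
    exact ((hF.comp h).sub (hUm.comp (hVm _))).abs
  set B1 := {ω | δ / 3 * (1 / (n : ℝ)) < |(⨆ r : Fin n, ⨆ i : Fin (n + 1),
    |Fr (r + 1) ω (V (evalNode i) ω) - Fr r ω (V (evalNode i) ω)|)|} with hB1
  set B2 := {ω | δ / 3 * 1 < |(⨆ i : Fin (n + 1),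
    |Fr 0 ω (Y (evalNode i) ω, X (evalNode i) ω, Zhat (evalNode i) ω)
      - Fr 0 ω (V (evalNode i) ω)|)|} with hB2
  have hclose : ∀ ω ∉ B1 ∪ B2, ∀ i, |S i ω - T (V (evalNode i) ω)| ≤ 2 * (δ / 3) + D i ω := by
    intro ω hω i
    simp only [Set.mem_union, hB1, hB2, Set.mem_ofPred_eq, not_or, not_lt] at hω
    obtain ⟨h1, h2⟩ := hω
    -- There are `n` replacements, each costing at most `δ / (3n)`.
    have h1' : |Fr n ω (V (evalNode i) ω) - Fr 0 ω (V (evalNode i) ω)| ≤ δ / 3 := by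
      refine (abs_sub_le_mul_iSup (fun r (i : Fin (n + 1)) => Fr r ω (V (evalNode i) ω)) i).trans ?_
      refine (mul_le_mul_of_nonneg_left ((le_abs_self _).trans h1) hn'.le).trans (le_of_eq ?_)
      field_simp
    have h2' : |Fr 0 ω (Y (evalNode i) ω, X (evalNode i) ω, Zhat (evalNode i) ω)
        - Fr 0 ω (V (evalNode i) ω)| ≤ δ / 3 := by
      refine (le_ciSup (f := fun i : Fin (n + 1) =>
        |Fr 0 ω (Y (evalNode i) ω, X (evalNode i) ω, Zhat (evalNode i) ω)
          - Fr 0 ω (V (evalNode i) ω)|) (Set.finite_range _).bddAbove i).trans ?_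
      linarith [(le_abs_self _).trans h2]
    have hSi : S i ω =
        |1 / 2 - Fr 0 ω (Y (evalNode i) ω, X (evalNode i) ω, Zhat (evalNode i) ω)| := by
      rw [hFr, mixedSample_zero]
      rfl
    have hTi : T (V (evalNode i) ω) = |1 / 2 - U (V (evalNode i) ω)| := rfl
    rw [hSi, hTi]
    refine (abs_abs_sub_abs_le_abs_sub _ _).trans ?_
    have hDi : D i ω = |Fr n ω (V (evalNode i) ω) - U (V (evalNode i) ω)| := rfl
    rw [hDi]
    have h1a := abs_le.1 h1'
    have h2a := abs_le.1 h2'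
    have h3a := neg_abs_le (Fr n ω (V (evalNode i) ω) - U (V (evalNode i) ω))
    have h4a := le_abs_self (Fr n ω (V (evalNode i) ω) - U (V (evalNode i) ω))
    rw [abs_le]
    constructor <;> linarith [h1a.1, h1a.2, h2a.1, h2a.2]
  -- Consistency is assumed only at the test node; this carries it to the validation nodes.
  have hc : ∀ i, ∫⁻ ω, ENNReal.ofReal (D i ω) ∂P = ∫⁻ ω, ENNReal.ofReal
      |Fr n ω (V (testNode n) ω) - U (V (testNode n) ω)| ∂P := by
    intro i
    have h := lintegral_estimation_error_eq hY hX hZ hiid hF hUm i (Fin.last n)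
    rw [evalNode_last] at h
    simp only [hD, hFrn]
    exact h
  have hTu : ∀ i u, 0 ≤ u → u < 1 / 2 → P.real {ω | T (V i ω) ≤ u} = 2 * u := fun i u h0 h1 =>
    measureReal_trueScore_le_of_iid hY hX hZ hiid (testNode n) hcont i h0 h1
  have hmain := measure_coverage_ne_le (P := P) hn (S := fun i => S i.castSucc)
    (T := fun i ω => T (V (evalNode i.castSucc) ω)) (D := fun i => D i.castSucc)
    (s := S (Fin.last n)) (t := fun ω => T (V (evalNode (Fin.last n)) ω)) (D' := D (Fin.last n))
    (fun i => hTm.comp (hVm _)) (hTm.comp (hVm _)) (fun i => hDm _) (hDm _)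
    ((hiid.indep.precomp (g := fun i : Fin n => evalNode i.castSucc)
      (evalNode_injective.comp (Fin.castSucc_injective n))).comp (fun _ => T) fun _ => hTm)
    (fun i => hTu _) (hTu _) (fun i => (hc i.castSucc).le) (hc (Fin.last n)).le hδ hlow hup hnδ
    (B := B1 ∪ B2) (fun ω hω i => hclose ω hω i.castSucc) (fun ω hω => hclose ω hω (Fin.last n))
  rw [evalNode_last] at hmain
  refine le_trans (le_of_eq ?_) (hmain.trans ?_)
  · congr 1
    ext ω
    simp only [Set.mem_ofPred_eq]
    rw [mem_conformalSet_iff hn F α (fun i => Y i ω) (fun i => X i ω) fun i => Zhat i ω]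
  · gcongr
    exact measure_union_le _ _

end FixedSize

/-! ### Asymptotic conditional validity -/

/-- Coverage by the conformal set agrees with coverage by the oracle set with probability tending
to one. -/
theorem tendsto_measure_cover_ne_oracle {d p : ℕ} {Ω : ℕ → Type*} [∀ n, MeasurableSpace (Ω n)]
    (P : ∀ n, Measure (Ω n)) [∀ n, IsProbabilityMeasure (P n)]
    (Y : ∀ n, Fin (2 * n + 1) → Ω n → ℝ) (X : ∀ n, Fin (2 * n + 1) → Ω n → Fin d → ℝ)
    (Z Zhat : ∀ n, Fin (2 * n + 1) → Ω n → Fin p → ℝ)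
    (hY : ∀ n i, Measurable (Y n i)) (hX : ∀ n i, Measurable (X n i))
    (hZ : ∀ n i, Measurable (Z n i))
    (hiid : ∀ n, IsIID (fun i ω => (Y n i ω, X n i ω, Z n i ω)) (P n))
    (hcont : ∀ n, (P n).map (fun ω =>
      (Y n (testNode n) ω, X n (testNode n) ω, Z n (testNode n) ω)) ≪ volume)
    (F : ∀ n, (Fin n → Triple d p) → Triple d p → ℝ)
    (hF : ∀ n, Measurable (Function.uncurry (F n)))
    (Fr : ∀ n, ℕ → Ω n → Triple d p → ℝ)
    (hFr : ∀ n r ω, Fr n r ω = F n (mixedSample r (fun i => Y n i ω) (fun i => X n i ω)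
      (fun i => Z n i ω) (fun i => Zhat n i ω)))
    {α : ℝ} (hα0 : 0 < α) (hα1 : α < 1)
    (htrain : IsLittleOP P (fun n ω => ⨆ r : Fin n, ⨆ i : Fin (n + 1),
        |Fr n (r + 1) ω (Y n (evalNode i) ω, X n (evalNode i) ω, Z n (evalNode i) ω)
          - Fr n r ω (Y n (evalNode i) ω, X n (evalNode i) ω, Z n (evalNode i) ω)|)
        (fun n => 1 / (n : ℝ)))
    (hinput : IsLittleOP P (fun n ω => ⨆ i : Fin (n + 1),
        |Fr n 0 ω (Y n (evalNode i) ω, X n (evalNode i) ω, Zhat n (evalNode i) ω)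
          - Fr n 0 ω (Y n (evalNode i) ω, X n (evalNode i) ω, Z n (evalNode i) ω)|)
        (fun _ => 1))
    (hmean : Tendsto (fun n => ∫⁻ ω, ENNReal.ofReal
        |Fr n n ω (Y n (testNode n) ω, X n (testNode n) ω, Z n (testNode n) ω)
          - trueCDF (P n) (Y n (testNode n)) (X n (testNode n)) (Z n (testNode n))
              (Y n (testNode n) ω, X n (testNode n) ω, Z n (testNode n) ω)| ∂(P n))
        atTop (𝓝 0)) :
    Tendsto (fun n => P n {ω | ¬ (Y n (testNode n) ω ∈ conformalSet (F n) α (fun i => Y n i ω)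
        (fun i => X n i ω) (fun i => Zhat n i ω) ↔
      trueScore (P n) (Y n (testNode n)) (X n (testNode n)) (Z n (testNode n))
        (Y n (testNode n) ω, X n (testNode n) ω, Z n (testNode n) ω) ≤ (1 - α) / 2)})
      atTop (𝓝 0) := by
  refine ENNReal.tendsto_nhds_zero.2 fun ε hε => ?_
  -- For fixed `δ` the term `14 * δ` is the only one that does not vanish as `n` grows, so it must
  -- be below `ε`; the other bounds keep the window around `(1 - α)/2` inside `(0, 1/2)`.
  obtain ⟨δ, hδ, hδε, hlow, hup⟩ : ∃ δ : ℝ, 0 < δ ∧ ENNReal.ofReal (14 * δ) < ε ∧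
      0 < (1 - α) / 2 - 4 * δ ∧ (1 - α) / 2 + 4 * δ < 1 / 2 := by
    have hlim : Tendsto (fun δ : ℝ => ENNReal.ofReal (14 * δ)) (𝓝[>] 0) (𝓝 0) := by
      have h : Continuous fun δ : ℝ => ENNReal.ofReal (14 * δ) :=
        ENNReal.continuous_ofReal.comp (by fun_prop)
      simpa using (h.tendsto 0).mono_left nhdsWithin_le_nhds
    have hsmall : ∀ᶠ δ in 𝓝[>] (0 : ℝ), δ < min ((1 - α) / 8) (α / 8) :=
      nhdsWithin_le_nhds (gt_mem_nhds (lt_min (by linarith) (by linarith)))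
    obtain ⟨δ, h1, h2, h3⟩ := ((hlim.eventually (gt_mem_nhds hε)).and
      (hsmall.and self_mem_nhdsWithin)).exists
    have h4 := lt_min_iff.1 h2
    exact ⟨δ, h3, h1, by linarith [h4.1], by linarith [h4.2]⟩
  have hcheb : Tendsto (fun n : ℕ => ENNReal.ofReal (1 / (n * (δ / 2) ^ 2))) atTop (𝓝 0) := by
    have h : Tendsto (fun n : ℕ => 1 / (n * (δ / 2) ^ 2)) atTop (𝓝 0) :=
      tendsto_const_nhds.div_atTop
        (tendsto_natCast_atTop_atTop.atTop_mul_const (by positivity))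
    simpa using ENNReal.tendsto_ofReal h
  have hdiv : ∀ a : ℝ, 0 < a → Tendsto (fun n => (∫⁻ ω, ENNReal.ofReal
        |Fr n n ω (Y n (testNode n) ω, X n (testNode n) ω, Z n (testNode n) ω)
          - trueCDF (P n) (Y n (testNode n)) (X n (testNode n)) (Z n (testNode n))
              (Y n (testNode n) ω, X n (testNode n) ω, Z n (testNode n) ω)| ∂(P n)) /
          ENNReal.ofReal a) atTop (𝓝 0) := fun a ha => by
    simpa using ENNReal.Tendsto.div_const hmean (b := ENNReal.ofReal a)
      (Or.inr (by simpa using ha))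
  have hsum := (tendsto_const_nhds (x := ENNReal.ofReal (14 * δ))).add
    (((htrain (δ / 3) (by positivity)).add (hinput (δ / 3) (by positivity))).add
    ((hdiv (δ / 3) (by positivity)).add ((hdiv (δ / 3 * (δ / 2)) (by positivity)).add
      (hcheb.add hcheb))))
  simp only [add_zero] at hsum
  filter_upwards [hsum.eventually (gt_mem_nhds hδε), eventually_ge_atTop 1,
    (tendsto_natCast_atTop_atTop.atTop_mul_const hδ).eventually (eventually_ge_atTop (1 - α))]
    with n hlt hn hnδ
  exact (measure_cover_ne_oracle_le hn (hY n) (hX n) (hZ n) (hiid n) (hcont n) (hF n) (hFr n) hδ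
    hlow hup hnδ).trans hlt.le

end NetConf

open NetConf

theorem mainTheorem2 {d p : ℕ} {Ω : ℕ → Type*} [∀ n, MeasurableSpace (Ω n)]
    (P : ∀ n, Measure (Ω n)) [∀ n, IsProbabilityMeasure (P n)]
    -- responses, covariates, latent positions, edge variables, sparsity, graphon
    (Y : ∀ n, Fin (2 * n + 1) → Ω n → ℝ)
    (X : ∀ n, Fin (2 * n + 1) → Ω n → Fin d → ℝ)
    (ξ : ∀ n, Fin (2 * n + 1) → Ω n → unitInterval)
    (η : ∀ n, Fin (2 * n + 1) → Fin (2 * n + 1) → Ω n → unitInterval)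
    (ρ : ℕ → ℝ) (w : unitInterval → unitInterval → ℝ) (hw : IsGraphon w)
    (hsetting : ∀ n, IsIndependentTriplets (P n) (Y n) (X n) (ξ n) (η n))
    (A : ∀ n, Ω n → Fin (2 * n + 1) → Fin (2 * n + 1) → ℝ)
    (hA : ∀ n ω, A n ω = adjacency (ρ n) w (fun i => ξ n i ω) (fun i j => η n i j ω))
    -- population network quantities, with i.i.d. and continuous triples
    (Z : ∀ n, Fin (2 * n + 1) → Ω n → Fin p → ℝ) (hZ : ∀ n i, Measurable (Z n i))
    (hiid : ∀ n, IsIID (fun i ω => (Y n i ω, X n i ω, Z n i ω)) (P n))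
    (hcont : ∀ n i, (P n).map (fun ω => (Y n i ω, X n i ω, Z n i ω)) ≪ volume)
    -- network covariates computed from the graph and the node covariates
    (ζ : ∀ n, (Fin (2 * n + 1) → Fin (2 * n + 1) → ℝ) → (Fin (2 * n + 1) → Fin d → ℝ) →
      Fin (2 * n + 1) → Fin p → ℝ)
    (hζ : ∀ n, Measurable (Function.uncurry (ζ n)))
    (hequiv : ∀ n, IsPermEquivariant (P n) (ζ n) (A n) (X n))
    (Zhat : ∀ n, Fin (2 * n + 1) → Ω n → Fin p → ℝ)
    (hZhat : ∀ n i ω, Zhat n i ω = ζ n (A n ω) (fun k => X n k ω) i)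
    -- estimator of the conditional distribution function from `n` training triples
    (F : ∀ n, (Fin n → Triple d p) → Triple d p → ℝ)
    (hF : ∀ n, Measurable (Function.uncurry (F n)))
    -- the estimator trained with the first `r` network covariates replaced by population values
    (Fr : ∀ n, ℕ → Ω n → Triple d p → ℝ)
    (hFr : ∀ n r ω, Fr n r ω = F n (mixedSample r (fun i => Y n i ω) (fun i => X n i ω)
      (fun i => Z n i ω) (fun i => Zhat n i ω)))
    (α : ℝ) (hα0 : 0 < α) (hα1 : α < 1)
    -- the event that the conformal set covers the response of the test node
    (cover : ∀ n, Set (Ω n))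
    (hcover : ∀ n, cover n = {ω | Y n (testNode n) ω ∈
      conformalSet (F n) α (fun i => Y n i ω) (fun i => X n i ω) (fun i => Zhat n i ω)}) :
    -- asymptotic conditional validity
    ( -- training example stability
      IsLittleOP P (fun n ω => ⨆ r : Fin n, ⨆ i : Fin (n + 1),
        |Fr n (r + 1) ω (Y n (evalNode i) ω, X n (evalNode i) ω, Z n (evalNode i) ω)
          - Fr n r ω (Y n (evalNode i) ω, X n (evalNode i) ω, Z n (evalNode i) ω)|)
        (fun n => 1 / (n : ℝ)) →
      -- input stability
      IsLittleOP P (fun n ω => ⨆ i : Fin (n + 1),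
        |Fr n 0 ω (Y n (evalNode i) ω, X n (evalNode i) ω, Zhat n (evalNode i) ω)
          - Fr n 0 ω (Y n (evalNode i) ω, X n (evalNode i) ω, Z n (evalNode i) ω)|)
        (fun _ => 1) →
      -- consistency of distribution regression in mean
      Tendsto (fun n => ∫⁻ ω, ENNReal.ofReal
        |Fr n n ω (Y n (testNode n) ω, X n (testNode n) ω, Z n (testNode n) ω)
          - trueCDF (P n) (Y n (testNode n)) (X n (testNode n)) (Z n (testNode n))
              (Y n (testNode n) ω, X n (testNode n) ω, Z n (testNode n) ω)| ∂(P n))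
        atTop (𝓝 0) →
      IsLittleOP P (fun n ω =>
        ((P n)⟦cover n | MeasurableSpace.comap
          (fun ω => (X n (testNode n) ω, Z n (testNode n) ω)) inferInstance⟧) ω - (1 - α))
        (fun _ => 1)) ∧
    -- unconditional validity, whether or not the three conditions hold
    (∀ n, 1 ≤ n → 1 - α ≤ (P n).real (cover n)) := by
  have hY : ∀ n i, Measurable (Y n i) := fun n => (hsetting n).measurable_Y
  have hX : ∀ n i, Measurable (X n i) := fun n => (hsetting n).measurable_X
  refine ⟨fun h1 h2 h3 => ?_, fun n hn => ?_⟩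
  · have hgap := tendsto_measure_cover_ne_oracle P Y X Z Zhat hY hX hZ hiid
      (fun n => hcont n (testNode n)) F hF Fr hFr hα0 hα1 h1 h2 h3
    intro ε hε
    have hgap' := ENNReal.Tendsto.div_const (b := ENNReal.ofReal ε) hgap
      (Or.inr (by simpa using hε))
    rw [ENNReal.zero_div] at hgap'
    refine tendsto_of_tendsto_of_tendsto_of_le_of_le' tendsto_const_nhds hgap'
      (Eventually.of_forall fun _ => bot_le) ?_
    filter_upwards [eventually_ge_atTop 1] with n hn
    have hmT : MeasurableSet {ω | trueScore (P n) (Y n (testNode n)) (X n (testNode n))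
        (Z n (testNode n)) (Y n (testNode n) ω, X n (testNode n) ω, Z n (testNode n) ω) ≤
          (1 - α) / 2} :=
      measurableSet_le (measurable_trueScore.comp
        ((hY n _).prodMk ((hX n _).prodMk (hZ n _)))) measurable_const
    have hmC : MeasurableSet (cover n) := by
      rw [hcover]
      exact measurableSet_cover hn (hF n)
        (measurable_observed_triples hw (hsetting n) (hA n) (hζ n) (hZhat n))
    have hcond := condExp_trueScore_le (hY n _) (hX n _) (hZ n _) (hcont n (testNode n))
      (t := (1 - α) / 2) (by linarith) (by linarith)
    -- The oracle threshold `(1 - α)/2` gives conditional coverage exactly `1 - α`.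
    rw [mul_div_cancel₀ _ (two_ne_zero' ℝ)] at hcond
    have h := measure_condExp_sub_le hmT hmC hcond hε
    simp only [mul_one]
    refine h.trans (le_of_eq ?_)
    rw [hcover]
    rfl
  · rw [hcover]
    exact le_measureReal_cover hn hw (hsetting n) (hA n) (hζ n) (hequiv n) (hZhat n) (hF n) hα0.le
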